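/- Let $\mathbb K\in\{\mathbb R,\mathbb C\}$, let $X$ be a $\mathbb K$-Banach space, $\mathcal L(X)$ the Banach algebra of bounded operators on $X$, and $GL(X)$ its group of invertible elements, regarded as an open submanifold of $\mathcal L(X)$. All manifolds are Hausdorff $\mathbb K$-analytic Banach manifolds (the charts may take values in different Banach spaces); submanifolds and submersions are split (the range, respectively the kernel, of the derivative is complemented). Let $\mathcal I(X)=\{Q\in\mathcal L(X)\setminus\{0,I\}: Q^2=Q\}$ with the norm topology. Let $\mathcal G(X)$ be the set of non-zero proper complemented closed subspaces of $X$, with the Grassmann manifold structure whose charts are, for $E,F\in\mathcal G(X)$ with $E\oplus F=X$, the inverses of the maps $T\mapsto (I+T)(E)$ from $\mathcal L(E,F)$ onto the set of complements of $F$. The group $GL(X)$ acts on $\mathcal I(X)$ by $(W,Q)\mapsto WQW^{-1}$ and on $\mathcal G(X)$ by $(W,E)\mapsto W(E)$; denote the stabilizers by $GL(X)^Q$ and $GL(X)^E$. Let $\kappa:\mathcal I(X)\to\mathcal G(X)$, $\kappa(Q)=Q(X)$. If $H$ is one of these stabilizers, $GL(X)/H$ carries the quotient topology and the manifold structure for which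 the quotient map $GL(X)\to GL(X)/H$ is an analytic submersion; such a structure exists. The set $\mathcal I(X)$ is a submanifold of $\mathcal L(X)$. With the induced manifold structure on $\mathcal I(X)$ the following hold for all $Q\in\mathcal I(X)$ and $E\in\mathcal G(X)$. 1. $GL(X)^Q$ and $GL(X)^E$ are analytic Banach Lie subgroups of $GL(X)$, that is, with the subspace topology they are submanifolds of $GL(X)$ with analytic group operations. 2. The orbits of $Q$ and of $E$ are open and closed in $\mathcal I(X)$ and in $\mathcal G(X)$, respectively. 3. The maps $\Sigma_Q:GL(X)/GL(X)^Q\to\mathcal I(X)$, $[W]\mapsto WQW^{-1}$, and $\Sigma^E:GL(X)/GL(X)^E\to\mathcal G(X)$, $[W]\mapsto W(E)$, are bi-analytic bijections onto the orbits of $Q$ and $E$, respectively. 4. Let $R\subseteq\mathcal I(X)$ contain exactly one point of each orbit (such sets exist). Then the maps $\Sigma_Q$, $Q\in R$, together define a bi-analytic bijection from the disjoint union $\bigsqcup_{Q\in R}GL(X)/GL(X)^Q$ onto $\mathcal I(X)$. Likewise, if $R\subseteq\mathcal G(X)$ contains exactly one point of each orbit (such sets exist), the maps $\Sigma^E$,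 $E\in R$, together define a bi-analytic bijection from $\bigsqcup_{E\in R}GL(X)/GL(X)^E$ onto $\mathcal G(X)$. 5. The assignment $\upsilon_0:[W]\mapsto[W]$ is a well-defined analytic map from $GL(X)/GL(X)^Q$ to $GL(X)/GL(X)^{Q(X)}$, and $\kappa\circ\Sigma_Q=\Sigma^{Q(X)}\circ\upsilon_0$. -/

import Mathlib

open Set Topology

universe w u

noncomputable section

namespace BanachHomog

/-! ### Analytic Banach manifolds

The charts of a Banach manifold may take values in different (possibly non-isomorphic) Banach
spaces, so an analytic structure is an atlas whose charts carry their own model spaces. -/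

/-- A (Hausdorff) analytic Banach manifold structure over `𝕜` on a topological space `M`: an
atlas of homeomorphisms from open subsets of `M` onto open subsets of Banach spaces, with analytic
coordinate changes. -/
structure BanachStructure (𝕜 : Type w) [NontriviallyNormedField 𝕜] (M : Type u)
    [TopologicalSpace M] where
  Index : Type u
  Model : Index → Type u
  [normed : ∀ i, NormedAddCommGroup (Model i)]
  [space : ∀ i, NormedSpace 𝕜 (Model i)]
  [complete : ∀ i, CompleteSpace (Model i)]
  chart : ∀ i, OpenPartialHomeomorph M (Model i)
  exists_mem_source : ∀ x, ∃ i, x ∈ (chart i).source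
  analytic_trans : ∀ i j,
    AnalyticOnNhd 𝕜 (chart j ∘ (chart i).symm) ((chart i).symm.trans (chart j)).source
  hausdorff : T2Space M

attribute [instance] BanachStructure.normed BanachStructure.space BanachStructure.complete

namespace BanachStructure

variable {𝕜 : Type w} [NontriviallyNormedField 𝕜]

section maps

variable {M N : Type u} [TopologicalSpace M] [TopologicalSpace N]

/-- The local representative of a map with respect to a chart of the source and a chart of the
target. -/
def localRep (A : BanachStructure 𝕜 M) (B : BanachStructure 𝕜 N) (f : M → N)
    (i : A.Index) (j : B.Index) : A.Model i → B.Model j :=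
  B.chart j ∘ f ∘ (A.chart i).symm

/-- A map between Banach manifolds is analytic at `x` if it is continuous at `x` and its local
representatives around `x` are analytic (have local power series expansions). -/
def IsAnalyticAt (A : BanachStructure 𝕜 M) (B : BanachStructure 𝕜 N) (f : M → N) (x : M) :
    Prop :=
  ContinuousAt f x ∧ ∀ i j, x ∈ (A.chart i).source → f x ∈ (B.chart j).source →
    AnalyticAt 𝕜 (localRep A B f i j) (A.chart i x)

def IsAnalytic (A : BanachStructure 𝕜 M) (B : BanachStructure 𝕜 N) (f : M → N) : Prop :=
  ∀ x, IsAnalyticAt A B f x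

/-- An analytic immersion: an analytic map all of whose derivatives are injective with closed
complemented range, i.e. have a continuous linear left inverse. -/
def IsImmersion (A : BanachStructure 𝕜 M) (B : BanachStructure 𝕜 N) (f : M → N) : Prop :=
  IsAnalytic A B f ∧ ∀ x i j, x ∈ (A.chart i).source → f x ∈ (B.chart j).source →
    (fderiv 𝕜 (localRep A B f i j) (A.chart i x)).HasLeftInverse

/-- An analytic submersion: an analytic map all of whose derivatives are surjective with
complemented kernel, i.e. have a continuous linear right inverse. -/
def IsSubmersion (A : BanachStructure 𝕜 M) (B : BanachStructure 𝕜 N) (f : M → N) : Prop :=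
  IsAnalytic A B f ∧ ∀ x i j, x ∈ (A.chart i).source → f x ∈ (B.chart j).source →
    (fderiv 𝕜 (localRep A B f i j) (A.chart i x)).HasRightInverse

/-- `f` is a bi-analytic bijection from `M` onto the open submanifold `U` of `N`. -/
def IsBianalyticOnto (A : BanachStructure 𝕜 M) (B : BanachStructure 𝕜 N) (f : M → N)
    (U : Set N) : Prop :=
  IsOpen U ∧ range f = U ∧ IsAnalytic A B f ∧
    ∃ g : N → M, Function.LeftInverse g f ∧ ∀ y ∈ U, IsAnalyticAt B A g y

end maps

/-- An open subset of a Banach space (given by an open embedding) as a Banach manifold, with the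
embedding as the only chart. -/
def ofIsOpenEmbedding {M V : Type u} [TopologicalSpace M] [Nonempty M] [NormedAddCommGroup V]
    [NormedSpace 𝕜 V] [CompleteSpace V] (f : M → V) (hf : IsOpenEmbedding f) :
    BanachStructure 𝕜 M where
  Index := PUnit
  Model := fun _ => V
  chart := fun _ => hf.toOpenPartialHomeomorph f
  exists_mem_source := fun x => ⟨⟨⟩, by simp⟩
  analytic_trans := by
    intro i j x hx
    refine (analyticAt_id (𝕜 := 𝕜) (z := x)).congr ?_
    have hx' : x ∈ (hf.toOpenPartialHomeomorph f).target := by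
      simp only [OpenPartialHomeomorph.trans_source, OpenPartialHomeomorph.symm_source] at hx
      exact hx.1
    filter_upwards [(hf.toOpenPartialHomeomorph f).open_target.mem_nhds hx'] with y hy
    exact ((hf.toOpenPartialHomeomorph f).right_inv hy).symm
  hausdorff := hf.toIsEmbedding.t2Space

/-- A Banach space as a Banach manifold. -/
def self (V : Type u) [NormedAddCommGroup V] [NormedSpace 𝕜 V] [CompleteSpace V] :
    BanachStructure 𝕜 V :=
  ofIsOpenEmbedding id IsOpenEmbedding.id

/-- The product of two Banach manifolds. -/
def prod {M N : Type u} [TopologicalSpace M] [TopologicalSpace N] (A : BanachStructure 𝕜 M)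
    (B : BanachStructure 𝕜 N) : BanachStructure 𝕜 (M × N) where
  Index := A.Index × B.Index
  Model := fun i => A.Model i.1 × B.Model i.2
  chart := fun i => (A.chart i.1).prod (B.chart i.2)
  exists_mem_source := fun x => by
    obtain ⟨i, hi⟩ := A.exists_mem_source x.1
    obtain ⟨j, hj⟩ := B.exists_mem_source x.2
    exact ⟨(i, j), hi, hj⟩
  analytic_trans := by
    rintro ⟨i, i'⟩ ⟨j, j'⟩ ⟨x, y⟩ h
    have hx : x ∈ ((A.chart i).symm.trans (A.chart j)).source := ⟨h.1.1, h.2.1⟩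
    have hy : y ∈ ((B.chart i').symm.trans (B.chart j')).source := ⟨h.1.2, h.2.2⟩
    exact ((A.analytic_trans i j x hx).comp_of_eq analyticAt_fst rfl).prod
      ((B.analytic_trans i' j' y hy).comp_of_eq analyticAt_snd rfl)
  hausdorff := by
    have := A.hausdorff
    have := B.hausdorff
    infer_instance

/-- The disjoint union of a family of Banach manifolds. -/
def sigma {I : Type u} {M : I → Type u} [∀ k, TopologicalSpace (M k)]
    (A : ∀ k, BanachStructure 𝕜 (M k)) : BanachStructure 𝕜 (Σ k, M k) where
  Index := Σ k, (A k).Index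
  Model := fun i => (A i.1).Model i.2
  chart := fun i => ((A i.1).chart i.2).lift_openEmbedding IsOpenEmbedding.sigmaMk
  exists_mem_source := by
    rintro ⟨k, x⟩
    obtain ⟨i, hi⟩ := (A k).exists_mem_source x
    exact ⟨⟨k, i⟩, ⟨x, hi, rfl⟩⟩
  analytic_trans := by
    rintro ⟨k, i⟩ ⟨l, j⟩ x ⟨hx, ⟨z, hz, hzx⟩⟩
    obtain rfl : l = k := congrArg Sigma.fst hzx
    have hzx' : z = ((A l).chart i).symm x := by
      simpa using hzx
    have h := (A l).analytic_trans i j x ⟨hx, by simpa [← hzx'] using hz⟩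
    refine h.congr (Filter.Eventually.of_forall fun y => ?_)
    exact (OpenPartialHomeomorph.lift_openEmbedding_apply _ IsOpenEmbedding.sigmaMk).symm
  hausdorff := by
    have := fun k => (A k).hausdorff
    infer_instance

end BanachStructure

/-! ### The general linear group, its Lie subgroups and homogeneous spaces -/

section GeneralLinear

variable (𝕜 : Type w) [NontriviallyNormedField 𝕜] (X : Type u) [NormedAddCommGroup X]
  [NormedSpace 𝕜 X]

/-- The group of invertible bounded operators on `X`, with the norm topology. -/
abbrev BanachGL : Type u := (X →L[𝕜] X)ˣ

/-- The Banach manifold structure of `GL X` as an open subset of the Banach algebra of bounded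
operators on `X`. -/
def glStructure [CompleteSpace X] : BanachStructure 𝕜 (BanachGL 𝕜 X) :=
  BanachStructure.ofIsOpenEmbedding Units.val Units.isOpenEmbedding_val

variable {𝕜 X} [CompleteSpace X]

/-- `H` is an analytic Banach Lie subgroup of `GL X`: with the subspace topology, `H` is a (split)
analytic submanifold of `GL X` for which the group operations are analytic. -/
def IsBanachLieSubgroup (H : Subgroup (BanachGL 𝕜 X)) : Prop :=
  ∃ A : BanachStructure 𝕜 H,
    A.IsImmersion (glStructure 𝕜 X) (fun W : H => (W : BanachGL 𝕜 X)) ∧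
    (A.prod A).IsAnalytic A (fun p : H × H => p.1 * p.2) ∧
    A.IsAnalytic A (fun W : H => W⁻¹)

/-- `A` is the manifold structure of the homogeneous space `GL X ⧸ H` (with the quotient
topology): the quotient map is an analytic submersion. -/
def IsHomogeneousStructure (H : Subgroup (BanachGL 𝕜 X)) (A : BanachStructure 𝕜 (BanachGL 𝕜 X ⧸ H)) : Prop :=
  (glStructure 𝕜 X).IsSubmersion A (fun W : BanachGL 𝕜 X => (W : BanachGL 𝕜 X ⧸ H))

end GeneralLinear

/-! ### The space of non-trivial idempotents -/

section Idem

variable (𝕜 : Type w) [NontriviallyNormedField 𝕜] (X : Type u) [NormedAddCommGroup X]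
  [NormedSpace 𝕜 X]

/-- Bounded idempotents on `X` other than `0` and the identity. -/
def Idem : Type u := {Q : X →L[𝕜] X // Q * Q = Q ∧ Q ≠ 0 ∧ Q ≠ 1}

/-- The norm topology. -/
instance : TopologicalSpace (Idem 𝕜 X) := instTopologicalSpaceSubtype

variable {𝕜 X}

/-- The action of `GL X` by conjugation. -/
instance : MulAction (BanachGL 𝕜 X) (Idem 𝕜 X) where
  smul W Q := ⟨W * Q.1 * (W⁻¹ : BanachGL 𝕜 X), by
    obtain ⟨Q, h, h0, h1⟩ := Q
    refine ⟨?_, ?_, ?_⟩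
    · calc (W * Q * (W⁻¹ : BanachGL 𝕜 X) : X →L[𝕜] X) * (W * Q * (W⁻¹ : BanachGL 𝕜 X))
          = W * (Q * Q) * (W⁻¹ : BanachGL 𝕜 X) := by simp [mul_assoc]
        _ = W * Q * (W⁻¹ : BanachGL 𝕜 X) := congrArg (fun T => W.val * T * (W⁻¹ : BanachGL 𝕜 X).val) h
    · intro hW
      apply h0
      calc Q = (W⁻¹ : BanachGL 𝕜 X) * (W * Q * (W⁻¹ : BanachGL 𝕜 X)) * W := by simp [mul_assoc]
        _ = 0 := by simp [hW]
    · intro hW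
      apply h1
      calc Q = (W⁻¹ : BanachGL 𝕜 X) * (W * Q * (W⁻¹ : BanachGL 𝕜 X)) * W := by simp [mul_assoc]
        _ = 1 := by simp [hW]⟩
  one_smul Q := Subtype.ext (by change ((1 : BanachGL 𝕜 X) * Q.1 * ((1 : BanachGL 𝕜 X)⁻¹ : BanachGL 𝕜 X) : X →L[𝕜] X) = _; simp)
  mul_smul V W Q := Subtype.ext (by
    change ((V * W : BanachGL 𝕜 X) * Q.1 * ((V * W)⁻¹ : BanachGL 𝕜 X) : X →L[𝕜] X) =
      V * (W * Q.1 * (W⁻¹ : BanachGL 𝕜 X)) * (V⁻¹ : BanachGL 𝕜 X)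
    simp [mul_assoc])

/-- `A` is the manifold structure on the set of idempotents as a (split) submanifold of the Banach
space of bounded operators: the inclusion is an analytic immersion (it is a topological embedding
by the choice of the topology). -/
def IsSubmanifoldStructure [CompleteSpace X] (A : BanachStructure 𝕜 (Idem 𝕜 X)) : Prop :=
  A.IsImmersion (BanachStructure.self (X →L[𝕜] X)) (fun Q : Idem 𝕜 X => Q.1)

end Idem

/-! ### The Grassmann manifold -/

section Grassmann

variable (𝕜 : Type w) [NontriviallyNormedField 𝕜] (X : Type u) [NormedAddCommGroup X]
  [NormedSpace 𝕜 X]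

/-- Non-zero proper (topologically) complemented subspaces of `X`. -/
def Grassmannian : Type u :=
  {E : Submodule 𝕜 X // E ≠ ⊥ ∧ E ≠ ⊤ ∧ E.ClosedComplemented}

variable {𝕜 X}

/-- The action of `GL X` by `W • E = W(E)`. -/
instance : MulAction (BanachGL 𝕜 X) (Grassmannian 𝕜 X) where
  smul W E := ⟨E.1.map (W : X →L[𝕜] X).toLinearMap, by
    obtain ⟨E, h0, h1, f, hf⟩ := E
    have hinv : ∀ x : X, (W⁻¹ : BanachGL 𝕜 X).val (W.val x) = x := fun x => by
      change ((W⁻¹ : BanachGL 𝕜 X).val * W.val) x = x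
      simp
    have hinv' : ∀ x : X, W.val ((W⁻¹ : BanachGL 𝕜 X).val x) = x := fun x => by
      change (W.val * (W⁻¹ : BanachGL 𝕜 X).val) x = x
      simp
    refine ⟨?_, ?_, ?_⟩
    · intro h
      apply h0
      rw [Submodule.eq_bot_iff] at h ⊢
      intro x hx
      have := h _ (Submodule.mem_map_of_mem hx)
      rw [← hinv x]
      change W.val x = 0 at this
      rw [this, map_zero]
    · intro h
      apply h1
      rw [Submodule.eq_top_iff'] at h ⊢
      intro x
      obtain ⟨y, hy, hyx⟩ := h (W.val x)
      change W.val y = W.val x at hyx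
      rw [← hinv x, ← hyx, hinv]
      exact hy
    · refine ⟨(W.val ∘L E.subtypeL ∘L f ∘L (W⁻¹ : BanachGL 𝕜 X).val).codRestrict _
        (fun x => Submodule.mem_map_of_mem (f _).2), ?_⟩
      rintro ⟨_, y, hy, rfl⟩
      apply Subtype.ext
      change W.val (f ((W⁻¹ : BanachGL 𝕜 X).val (W.val y))) = W.val y
      rw [hinv, hf ⟨y, hy⟩]⟩
  one_smul E := Subtype.ext (Submodule.map_id _)
  mul_smul V W E := Subtype.ext (Submodule.map_comp _ _ _)

/-- The range map from idempotents to complemented subspaces. -/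
def kappa (Q : Idem 𝕜 X) : Grassmannian 𝕜 X :=
  ⟨Q.1.toLinearMap.range, by
    obtain ⟨Q, h, h0, h1⟩ := Q
    have hQ : ∀ x, Q (Q x) = Q x := fun x => congrArg (fun T : X →L[𝕜] X => T x) h
    refine ⟨?_, ?_, ?_⟩
    · intro hb
      apply h0
      ext x
      have : Q x ∈ Q.toLinearMap.range := ⟨x, rfl⟩
      rw [hb] at this
      simpa using this
    · intro ht
      apply h1
      ext x
      have : x ∈ Q.toLinearMap.range := ht ▸ Submodule.mem_top
      obtain ⟨y, rfl⟩ := this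
      exact hQ y
    · refine ⟨Q.codRestrict _ fun x => ⟨x, rfl⟩, ?_⟩
      rintro ⟨_, y, rfl⟩
      exact Subtype.ext (hQ y)⟩

/-- The graph `(I + T)(E)` of an operator `T : E → F` in `X`. -/
def graph {E F : Submodule 𝕜 X} (T : E →L[𝕜] F) : Submodule 𝕜 X :=
  (E.subtypeL + F.subtypeL ∘L T).toLinearMap.range

theorem mem_graph {E F : Submodule 𝕜 X} {T : E →L[𝕜] F} {x : X} :
    x ∈ graph T ↔ ∃ e : E, (e : X) + T e = x := Iff.rfl

theorem isTopCompl_graph {E F : Submodule 𝕜 X} (h : E.IsTopCompl F) (T : E →L[𝕜] F) :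
    (graph T).IsTopCompl F := by
  have key : ∀ e : E, E.projectionOntoL F h ((e : X) + T e) = e := fun e => by simp
  have hp := ContinuousLinearMap.isTopCompl_of_proj (p := graph T)
    (f := ((E.subtypeL + F.subtypeL ∘L T) ∘L E.projectionOntoL F h).codRestrict (graph T)
      fun x => ⟨_, rfl⟩) (by
        rintro ⟨_, e, rfl⟩
        apply Subtype.ext
        change ((E.projectionOntoL F h ((e : X) + T e) : E) : X) +
          T (E.projectionOntoL F h ((e : X) + T e)) = (e : X) + T e
        rw [key])
  refine (congrArg (Submodule.IsTopCompl (graph T)) ?_).mp hp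
  ext x
  rw [← Submodule.projectionOntoL_apply_eq_zero_iff h, LinearMap.mem_ker]
  symm
  constructor
  · intro hx
    apply Subtype.ext
    change ((E.projectionOntoL F h x : E) : X) + T (E.projectionOntoL F h x) = 0
    rw [hx]; simp
  · intro hx
    have hx' : ((E.projectionOntoL F h x : E) : X) + T (E.projectionOntoL F h x) = 0 :=
      congrArg Subtype.val hx
    rw [← key (E.projectionOntoL F h x), hx', map_zero]

/-- The pairs `(E, F)` of complementary elements of the Grassmannian. -/
abbrev ComplPair (𝕜 : Type w) [NontriviallyNormedField 𝕜] (X : Type u) [NormedAddCommGroup X]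
    [NormedSpace 𝕜 X] : Type u :=
  {p : Grassmannian 𝕜 X × Grassmannian 𝕜 X // IsCompl p.1.1 p.2.1}

theorem exists_complPair (E : Grassmannian 𝕜 X) : ∃ i : ComplPair 𝕜 X, i.1.1 = E := by
  have hc := E.2.2.2.isTopCompl_complement
  refine ⟨⟨(E, ⟨E.2.2.2.complement, ?_, ?_, hc.symm.closedComplemented⟩), hc.isCompl⟩, rfl⟩
  · intro h
    have := hc.isCompl.sup_eq_top
    rw [h] at this
    exact E.2.2.1 (by simpa using this)
  · intro h
    have := hc.isCompl.inf_eq_bot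
    rw [h] at this
    exact E.2.1 (by simpa using this)

variable [CompleteSpace X]

theorem Grassmannian.isTopCompl {E F : Grassmannian 𝕜 X} (h : IsCompl E.1 F.1) :
    E.1.IsTopCompl F.1 :=
  Submodule.IsCompl.isTopCompl_of_isClosed h E.2.2.2.isClosed F.2.2.2.isClosed

instance (E : Grassmannian 𝕜 X) : CompleteSpace E.1 := E.2.2.2.isClosed.completeSpace_coe

/-- The parametrization `T ↦ (I + T)(E)` of the set of complements of `F` by operators `E → F`. -/
def param (i : ComplPair 𝕜 X) (T : i.1.1.1 →L[𝕜] i.1.2.1) : Grassmannian 𝕜 X :=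
  ⟨graph T, by
    obtain ⟨⟨E, F⟩, h⟩ := i
    have hc := (isTopCompl_graph (Grassmannian.isTopCompl h) T)
    refine ⟨?_, ?_, hc.closedComplemented⟩
    · intro hb
      have := hc.isCompl
      rw [hb] at this
      exact F.2.2.1 (by simpa using this.sup_eq_top)
    · intro ht
      have := hc.isCompl
      rw [ht] at this
      exact F.2.1 (by simpa using this.inf_eq_bot)⟩

open Classical in
/-- The coordinate map, defined on the complements `G` of `F`: the operator `T : E → F` with
`(I + T)(E) = G`, i.e. minus the restriction to `E` of the projection onto `F` along `G`. -/
def coord (i : ComplPair 𝕜 X) (G : Grassmannian 𝕜 X) : i.1.1.1 →L[𝕜] i.1.2.1 :=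
  if h : IsCompl G.1 i.1.2.1 then
    -((i.1.2.1).projectionOntoL G.1 (Grassmannian.isTopCompl h).symm ∘L (i.1.1.1).subtypeL)
  else 0

theorem isCompl_param (i : ComplPair 𝕜 X) (T : i.1.1.1 →L[𝕜] i.1.2.1) :
    IsCompl (param i T).1 i.1.2.1 :=
  (isTopCompl_graph (Grassmannian.isTopCompl i.2) T).isCompl

theorem coord_eq (i : ComplPair 𝕜 X) {G : Grassmannian 𝕜 X} (h : IsCompl G.1 i.1.2.1)
    (S : i.1.1.1 →L[𝕜] i.1.2.1) (hS : ∀ e : i.1.1.1, (e : X) + S e ∈ G.1) : coord i G = S := by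
  have hG := (Grassmannian.isTopCompl h).symm
  ext1 e
  have h0 := (Submodule.projectionOntoL_apply_eq_zero_iff hG).2 (hS e)
  rw [map_add, Submodule.projectionOntoL_apply_left hG] at h0
  rw [coord, dif_pos h]
  exact (eq_neg_of_add_eq_zero_right h0).symm

theorem add_coord_mem (i : ComplPair 𝕜 X) {G : Grassmannian 𝕜 X} (h : IsCompl G.1 i.1.2.1)
    (e : i.1.1.1) : (e : X) + coord i G e ∈ G.1 := by
  have hG := (Grassmannian.isTopCompl h).symm
  rw [← Submodule.projectionOntoL_apply_eq_zero_iff hG, map_add, Submodule.projectionOntoL_apply_left hG, coord,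
    dif_pos h]
  exact add_neg_cancel _

theorem param_coord (i : ComplPair 𝕜 X) {G : Grassmannian 𝕜 X} (h : IsCompl G.1 i.1.2.1) :
    param i (coord i G) = G := by
  have hle : (param i (coord i G)).1 ≤ G.1 := by
    rintro _ ⟨e, rfl⟩
    exact add_coord_mem i h e
  refine Subtype.ext (eq_of_le_of_inf_le_of_sup_le (z := i.1.2.1) hle ?_ ?_)
  · rw [h.inf_eq_bot]; exact bot_le
  · rw [(isCompl_param i _).sup_eq_top]; exact le_top

/-- The manifold topology of the Grassmannian: the final topology of the parametrizations. -/
instance : TopologicalSpace (Grassmannian 𝕜 X) :=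
  ⨆ i : ComplPair 𝕜 X, TopologicalSpace.coinduced (param i) inferInstance

theorem isOpen_iff {U : Set (Grassmannian 𝕜 X)} :
    IsOpen U ↔ ∀ i : ComplPair 𝕜 X, IsOpen (param i ⁻¹' U) := by
  rw [isOpen_iSup_iff]
  rfl

theorem continuous_param (i : ComplPair 𝕜 X) : Continuous (param i) :=
  continuous_def.2 fun _ hU => isOpen_iff.1 hU i

/-- The operator comparing the parametrizations `i` and `j`: `T ↦ P (I + T)`, with `P` the
projection onto the first member of `j` along the second one. -/
def compar (i j : ComplPair 𝕜 X) (T : i.1.1.1 →L[𝕜] i.1.2.1) : i.1.1.1 →L[𝕜] j.1.1.1 :=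
  (j.1.1.1).projectionOntoL j.1.2.1 (Grassmannian.isTopCompl j.2) ∘L
    ((i.1.1.1).subtypeL + (i.1.2.1).subtypeL ∘L T)

/-- The expression for the coordinate change from `i` to `j`. -/
def coordChange (i j : ComplPair 𝕜 X) (T : i.1.1.1 →L[𝕜] i.1.2.1) : j.1.1.1 →L[𝕜] j.1.2.1 :=
  ((j.1.2.1).projectionOntoL j.1.1.1 (Grassmannian.isTopCompl j.2).symm ∘L
    ((i.1.1.1).subtypeL + (i.1.2.1).subtypeL ∘L T)) ∘L (compar i j T).inverse

theorem analyticAt_coordChange (i j : ComplPair 𝕜 X) {T : i.1.1.1 →L[𝕜] i.1.2.1}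
    (hT : (compar i j T).IsInvertible) : AnalyticAt 𝕜 (coordChange i j) T := by
  apply ContDiffAt.analyticAt
  have h1 : ContDiff 𝕜 ⊤ (compar i j) := by unfold compar; fun_prop
  have h2 : ContDiffAt 𝕜 ⊤ (fun T => (compar i j T).inverse) T :=
    (hT.contDiffAt_map_inverse).comp T h1.contDiffAt
  unfold coordChange
  exact ContDiffAt.clm_comp (by fun_prop) h2

theorem isCompl_param_iff (i j : ComplPair 𝕜 X) (T : i.1.1.1 →L[𝕜] i.1.2.1) :
    IsCompl (param i T).1 j.1.2.1 ↔ (compar i j T).IsInvertible := by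
  have hi := Grassmannian.isTopCompl i.2
  have hj := Grassmannian.isTopCompl j.2
  have key : ∀ e : i.1.1.1, (i.1.1.1).projectionOntoL i.1.2.1 hi ((e : X) + T e) = e :=
    fun e => by simp
  have hA : ∀ e, compar i j T e = (j.1.1.1).projectionOntoL j.1.2.1 hj ((e : X) + T e) :=
    fun _ => rfl
  have hker : ∀ e, compar i j T e = 0 ↔ (e : X) + T e ∈ j.1.2.1 := fun e => by
    rw [hA, Submodule.projectionOntoL_apply_eq_zero_iff hj]
  constructor
  · intro h
    have hinj : Function.Injective (compar i j T) := by
      rw [injective_iff_map_eq_zero]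
      intro e he
      have h0 : (e : X) + T e = 0 :=
        Submodule.disjoint_def.1 h.disjoint _ ⟨e, rfl⟩ ((hker e).1 he)
      rw [← key e, h0, map_zero]
    have hsurj : Function.Surjective (compar i j T) := by
      intro x
      obtain ⟨g, hg, f, hf, hx⟩ := Submodule.mem_sup.1
        (show (x : X) ∈ (param i T).1 ⊔ j.1.2.1 by rw [h.sup_eq_top]; exact Submodule.mem_top)
      obtain ⟨e, rfl⟩ := hg
      refine ⟨e, ?_⟩
      have hf0 := (Submodule.projectionOntoL_apply_eq_zero_iff hj).2 hf
      have := congrArg ((j.1.1.1).projectionOntoL j.1.2.1 hj) hx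
      rw [map_add, hf0, add_zero, Submodule.projectionOntoL_apply_left hj] at this
      exact this
    exact ⟨ContinuousLinearEquiv.ofBijective (compar i j T) (LinearMap.ker_eq_bot.2 hinj)
      (LinearMap.range_eq_top.2 hsurj), ContinuousLinearEquiv.coe_ofBijective _ _ _⟩
  · rintro ⟨A, hAe⟩
    have hAe' : ∀ e, A e = compar i j T e := fun e => by rw [← hAe]; rfl
    constructor
    · rw [Submodule.disjoint_def]
      rintro _ ⟨e, rfl⟩ hx
      have he : A e = 0 := by rw [hAe']; exact (hker e).2 hx
      have : e = 0 := by simpa using he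
      subst this
      simp
    · rw [codisjoint_iff, eq_top_iff]
      intro x _
      set e := A.symm ((j.1.1.1).projectionOntoL j.1.2.1 hj x) with he
      have h1 : compar i j T e = (j.1.1.1).projectionOntoL j.1.2.1 hj x := by
        rw [← hAe', he, A.apply_symm_apply]
      refine Submodule.mem_sup.2 ⟨(e : X) + T e, ⟨e, rfl⟩, x - ((e : X) + T e), ?_, by abel⟩
      rw [← Submodule.projectionOntoL_apply_eq_zero_iff hj, map_sub, ← hA, h1, sub_self]

theorem coord_param (i j : ComplPair 𝕜 X) {T : i.1.1.1 →L[𝕜] i.1.2.1}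
    (hT : (compar i j T).IsInvertible) : coord j (param i T) = coordChange i j T := by
  have hj := Grassmannian.isTopCompl j.2
  refine coord_eq j ((isCompl_param_iff i j T).2 hT) _ fun x => ?_
  obtain ⟨A, hA⟩ := hT
  have hAe : ∀ e, A e = compar i j T e := fun e => by rw [← hA]; rfl
  refine ⟨A.symm x, ?_⟩
  have h1 : (j.1.1.1).projectionOntoL j.1.2.1 hj ((A.symm x : X) + T (A.symm x)) = x :=
    (hAe _).symm.trans (A.apply_symm_apply x)
  have h2 : coordChange i j T x = (j.1.2.1).projectionOntoL j.1.1.1 hj.symm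
      ((A.symm x : X) + T (A.symm x)) := by
    simp only [coordChange, ← hA, ContinuousLinearMap.inverse_equiv]
    rfl
  have h3 := Submodule.projectionL_add_projectionL_eq_self hj ((A.symm x : X) + T (A.symm x))
  rw [h2]
  exact h3.symm.trans (congrArg (fun y : j.1.1.1 =>
    (y : X) + _) h1)

theorem isOpen_invertible (i j : ComplPair 𝕜 X) :
    IsOpen {T : i.1.1.1 →L[𝕜] i.1.2.1 | (compar i j T).IsInvertible} := by
  have h1 : Continuous (compar i j) := by unfold compar; fun_prop
  exact (ContinuousLinearEquiv.isOpen (𝕜 := 𝕜) (E := i.1.1.1) (F := j.1.1.1)).preimage h1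

/-- The chart of the Grassmannian attached to a pair `(E, F)` of complementary subspaces: its
domain is the set of complements of `F`, and it takes values in the space of operators `E → F`. -/
def grassmannChart (i : ComplPair 𝕜 X) :
    OpenPartialHomeomorph (Grassmannian 𝕜 X) (i.1.1.1 →L[𝕜] i.1.2.1) where
  toFun := coord i
  invFun := param i
  source := {G | IsCompl G.1 i.1.2.1}
  target := univ
  map_source' _ _ := mem_univ _
  map_target' T _ := isCompl_param i T
  left_inv' _ h := param_coord i h
  right_inv' T _ := coord_eq i (isCompl_param i T) T fun e => ⟨e, rfl⟩
  open_source := isOpen_iff.2 fun k => by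
    simpa only [preimage_ofPred_eq, isCompl_param_iff] using isOpen_invertible k i
  open_target := isOpen_univ
  continuousOn_toFun := by
    have hs : IsOpen {G : Grassmannian 𝕜 X | IsCompl G.1 i.1.2.1} := isOpen_iff.2 fun k => by
      simpa only [preimage_ofPred_eq, isCompl_param_iff] using isOpen_invertible k i
    rw [continuousOn_open_iff hs]
    intro V hV
    refine isOpen_iff.2 fun k => ?_
    have hc : ContinuousOn (coordChange k i)
        {T | (compar k i T).IsInvertible} := fun T hT =>
      (analyticAt_coordChange k i hT).continuousAt.continuousWithinAt
    convert hc.isOpen_inter_preimage (isOpen_invertible k i) hV using 1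
    ext T
    simp only [mem_preimage, mem_inter_iff, mem_ofPred_eq, isCompl_param_iff]
    refine and_congr_right fun hT => ?_
    rw [coord_param k i hT]
  continuousOn_invFun := (continuous_param i).continuousOn

theorem t2Space_grassmannian : T2Space (Grassmannian 𝕜 X) := by
  have main : ∀ E E' : Grassmannian 𝕜 X, ¬ E.1 ≤ E'.1 →
      ∃ U V : Set (Grassmannian 𝕜 X), IsOpen U ∧ IsOpen V ∧ E ∈ U ∧ E' ∈ V ∧ Disjoint U V := by
    intro E E' hE
    obtain ⟨x, hx, hx'⟩ := SetLike.not_le_iff_exists.1 hE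
    obtain ⟨i, rfl⟩ := exists_complPair E
    obtain ⟨j, rfl⟩ := exists_complPair E'
    have hj := Grassmannian.isTopCompl j.2
    let P := (j.1.1.1).projectionOntoL j.1.2.1 hj
    let R := (j.1.2.1).projectionOntoL j.1.1.1 hj.symm
    let Φ : (i.1.1.1 →L[𝕜] i.1.2.1) × (j.1.1.1 →L[𝕜] j.1.2.1) → j.1.2.1 := fun p =>
      R (x + p.1 ⟨x, hx⟩) - p.2 (P (x + p.1 ⟨x, hx⟩))
    have hΦ : Continuous Φ := by fun_prop
    have h0 : Φ (0, 0) ≠ 0 := by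
      intro h
      apply hx'
      rw [← Submodule.projectionOntoL_apply_eq_zero_iff hj.symm]
      have h' : R (x + 0) - 0 = 0 := h
      rw [add_zero, sub_zero] at h'
      exact h'
    obtain ⟨U, V, hU, hU0, hV, hV0, hUV⟩ := mem_nhds_prod_iff'.1
      ((isOpen_ne.preimage hΦ).mem_nhds (x := (0, 0)) h0)
    have self_mem : ∀ k : ComplPair 𝕜 X, param k 0 = k.1.1 := fun k => by
      apply Subtype.ext
      ext y
      refine ⟨?_, fun hy => ⟨⟨y, hy⟩, ?_⟩⟩
      · rintro ⟨e, rfl⟩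
        simp
      · simp
    refine ⟨param i '' U, param j '' V,
      (grassmannChart i).isOpen_image_symm_of_subset_target hU (subset_univ _),
      (grassmannChart j).isOpen_image_symm_of_subset_target hV (subset_univ _),
      ⟨0, hU0, self_mem i⟩, ⟨0, hV0, self_mem j⟩, ?_⟩
    rw [Set.disjoint_left]
    rintro _ ⟨T, hT, rfl⟩ ⟨S, hS, hST⟩
    have hmem : x + T ⟨x, hx⟩ ∈ (param j S).1 := by
      rw [hST]
      exact ⟨⟨x, hx⟩, rfl⟩
    obtain ⟨e, he⟩ := hmem
    change (e : X) + S e = x + T ⟨x, hx⟩ at he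
    apply hUV (mk_mem_prod hT hS)
    change R (x + T ⟨x, hx⟩) - S (P (x + T ⟨x, hx⟩)) = 0
    have hP : P ((e : X) + S e) = e := by simp [P]
    have hR : R ((e : X) + S e) = S e := by simp [R]
    rw [← he, hP, hR, sub_self]
  refine ⟨fun E E' hne => ?_⟩
  by_cases h : E.1 ≤ E'.1
  · have h' : ¬ E'.1 ≤ E.1 := fun h' => hne (Subtype.ext (le_antisymm h h'))
    obtain ⟨U, V, hU, hV, h1, h2, h3⟩ := main E' E h'
    exact ⟨V, U, hV, hU, h2, h1, h3.symm⟩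
  · exact main E E' h

variable (𝕜 X) in
/-- The Grassmann manifold of `X`. -/
def grassmannStructure : BanachStructure 𝕜 (Grassmannian 𝕜 X) where
  Index := ComplPair 𝕜 X
  Model := fun i => i.1.1.1 →L[𝕜] i.1.2.1
  chart := grassmannChart
  exists_mem_source := fun E => by
    obtain ⟨i, rfl⟩ := exists_complPair E
    exact ⟨i, i.2⟩
  analytic_trans := fun i j T hT => by
    have hT' : (compar i j T).IsInvertible := (isCompl_param_iff i j T).1 hT.2
    refine (analyticAt_coordChange i j hT').congr ?_
    filter_upwards [(isOpen_invertible i j).mem_nhds hT'] with S hS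
    exact (coord_param i j hS).symm
  hausdorff := t2Space_grassmannian

end Grassmann

/-! ### Disjoint unions of homogeneous spaces -/

/-- `R` contains exactly one point of each orbit of the action of `G` on `Y`. -/
def IsOrbitTransversal (G : Type u) {Y : Type u} [Group G] [MulAction G Y] (R : Set Y) : Prop :=
  ∀ y : Y, ∃! q : Y, q ∈ R ∧ y ∈ MulAction.orbit G q

end BanachHomog

end

open BanachHomog

namespace BanachHomog

open Filter

namespace BanachStructure

/-! ### Calculus of analytic maps in charts. -/

section Basic

variable {𝕜 : Type w} [NontriviallyNormedField 𝕜] {M N P : Type u} [TopologicalSpace M]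
  [TopologicalSpace N] [TopologicalSpace P] {A : BanachStructure 𝕜 M} {B : BanachStructure 𝕜 N}
  {C : BanachStructure 𝕜 P}

/-! Almost everything follows from one property of an action of `GL X` on a manifold `Y`,
`HasAnalyticOrbits`: orbit maps `W ↦ W • y` are analytic, and near each `y` there is an analytic `s`
with values in `GL X`, `s y = 1` and `s z • y = z`. Such an `s` shows that a neighbourhood of `y`
lies in its orbit. So orbits are open, and closed because they partition `Y`. Locally the inverse of
`[W] ↦ W • y` is the class of `s`, which makes this map an open embedding. Pulling the structure of
`Y` back along it gives a homogeneous structure. For any homogeneous structure the map is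
bi-analytic onto the orbit, and the disjoint unions follow because orbits are open.

The sections are explicit. For idempotents, `P * Q + (1 - P) * (1 - Q)` intertwines `Q` and `P` and
equals `1` at `P = Q`, hence is invertible nearby. For subspaces, the shear `I + T` maps `E` onto
the graph of `T : E → F`.

Two points are separate. Each stabilizer consists of the units of a complemented closed subalgebra
whose inverses lie there too: the commutant of `Q`, or the operators leaving `E` invariant. The
units of a Banach algebra are open, so one chart suffices. The idempotents form a submanifold by the
parametrization `T ↦ (1 + T) Q (1 + T)⁻¹` with `T` off-diagonal, inverted by normalizing the
intertwiner to have diagonal part `1`.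

Manifold structures on the quotients and on the idempotents are arbitrary ones with the submersion
or immersion property. The inverse function theorem turns these properties into local sections and
retractions (`IsSubmersion.exists_section`, `IsImmersion.exists_retraction`), which is all that is
needed of them. -/

theorem localRep_comp_eventuallyEq {f : M → N} {g : N → P} {x : M} (hf : ContinuousAt f x)
    {i : A.Index} {j : B.Index} (k : C.Index) (hi : x ∈ (A.chart i).source)
    (hj : f x ∈ (B.chart j).source) :
    localRep A C (g ∘ f) i k =ᶠ[𝓝 (A.chart i x)]
      localRep B C g j k ∘ localRep A B f i j := by
  have hc : Tendsto (fun y => f ((A.chart i).symm y)) (𝓝 (A.chart i x)) (𝓝 (f x)) := by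
    refine hf.tendsto.comp ?_
    have := (A.chart i).symm.continuousAt ((A.chart i).map_source hi)
    rwa [ContinuousAt, (A.chart i).left_inv hi] at this
  filter_upwards [hc.eventually ((B.chart j).open_source.mem_nhds hj)] with y hy
  simp only [localRep, Function.comp_apply]
  rw [(B.chart j).left_inv hy]

theorem localRep_apply (f : M → N) {x : M} {i : A.Index} (j : B.Index)
    (hi : x ∈ (A.chart i).source) : localRep A B f i j (A.chart i x) = B.chart j (f x) := by
  simp [localRep, (A.chart i).left_inv hi]

theorem localRep_congr {f g : M → N} {x : M} (h : f =ᶠ[𝓝 x] g) {i : A.Index} (j : B.Index)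
    (hi : x ∈ (A.chart i).source) :
    localRep A B f i j =ᶠ[𝓝 (A.chart i x)] localRep A B g i j := by
  have hc : Tendsto (A.chart i).symm (𝓝 (A.chart i x)) (𝓝 x) := by
    have := (A.chart i).symm.continuousAt ((A.chart i).map_source hi)
    rwa [ContinuousAt, (A.chart i).left_inv hi] at this
  filter_upwards [hc.eventually h] with y hy
  simp only [localRep, Function.comp_apply]
  rw [hy]

theorem localRep_id_eventuallyEq {x : M} {i : A.Index} (hi : x ∈ (A.chart i).source) :
    localRep A A id i i =ᶠ[𝓝 (A.chart i x)] id := by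
  filter_upwards [(A.chart i).open_target.mem_nhds ((A.chart i).map_source hi)] with y hy
  exact (A.chart i).right_inv hy

theorem analyticAt_localRep_id {x : M} {i j : A.Index} (hi : x ∈ (A.chart i).source)
    (hj : x ∈ (A.chart j).source) : AnalyticAt 𝕜 (localRep A A id i j) (A.chart i x) :=
  A.analytic_trans i j _ (by
    rw [OpenPartialHomeomorph.trans_source]
    refine ⟨(A.chart i).map_source hi, ?_⟩
    rwa [mem_preimage, (A.chart i).left_inv hi])

/-- Analyticity at a point can be tested in a single pair of charts. -/
theorem isAnalyticAt_of_chart {f : M → N} {x : M} (hf : ContinuousAt f x) {i : A.Index}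
    {j : B.Index} (hi : x ∈ (A.chart i).source) (hj : f x ∈ (B.chart j).source)
    (h : AnalyticAt 𝕜 (localRep A B f i j) (A.chart i x)) : IsAnalyticAt A B f x := by
  refine ⟨hf, fun k l hk hl => ?_⟩
  have h1 : localRep A B f k l =ᶠ[𝓝 (A.chart k x)]
      localRep A B f i l ∘ localRep A A id k i :=
    localRep_comp_eventuallyEq (f := id) (g := f) continuousAt_id l hk hi
  have h2 : localRep A B f i l =ᶠ[𝓝 (A.chart i x)]
      localRep B B id j l ∘ localRep A B f i j :=
    localRep_comp_eventuallyEq (f := f) (g := id) hf l hi hj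
  have h3 : AnalyticAt 𝕜 (localRep A B f i l) (A.chart i x) := by
    refine AnalyticAt.congr ?_ h2.symm
    exact (analyticAt_localRep_id hj hl).comp_of_eq h (localRep_apply f j hi)
  exact AnalyticAt.congr (h3.comp_of_eq (analyticAt_localRep_id hk hi) (localRep_apply id i hk))
    h1.symm

theorem IsAnalyticAt.comp {f : M → N} {g : N → P} {x : M} (hg : IsAnalyticAt B C g (f x))
    (hf : IsAnalyticAt A B f x) : IsAnalyticAt A C (g ∘ f) x := by
  obtain ⟨i, hi⟩ := A.exists_mem_source x
  obtain ⟨j, hj⟩ := B.exists_mem_source (f x)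
  obtain ⟨k, hk⟩ := C.exists_mem_source (g (f x))
  refine isAnalyticAt_of_chart (hg.1.comp hf.1) hi hk ?_
  exact AnalyticAt.congr ((hg.2 j k hj hk).comp_of_eq (hf.2 i j hi hj) (localRep_apply f j hi))
    (localRep_comp_eventuallyEq hf.1 k hi hj).symm

theorem IsAnalyticAt.comp_of_eq {f : M → N} {g : N → P} {x : M} {y : N}
    (hg : IsAnalyticAt B C g y) (hf : IsAnalyticAt A B f x) (h : f x = y) :
    IsAnalyticAt A C (g ∘ f) x := by
  subst h
  exact hg.comp hf

theorem IsAnalyticAt.congr {f g : M → N} {x : M} (hf : IsAnalyticAt A B f x)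
    (h : f =ᶠ[𝓝 x] g) : IsAnalyticAt A B g x := by
  refine ⟨hf.1.congr h, fun i j hi hj => ?_⟩
  rw [← h.self_of_nhds] at hj
  exact (hf.2 i j hi hj).congr (localRep_congr h j hi)

/-- If `g ∘ f` is the identity near `x`, the derivative of `g` at `f x` is a left inverse of the
derivative of `f` at `x`. -/
theorem leftInverse_fderiv_localRep {f : M → N} {g : N → M} {x : M} (hf : IsAnalyticAt A B f x)
    (hg : IsAnalyticAt B A g (f x)) (h : g ∘ f =ᶠ[𝓝 x] id) {i : A.Index} {j : B.Index}
    (hi : x ∈ (A.chart i).source) (hj : f x ∈ (B.chart j).source) :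
    Function.LeftInverse (fderiv 𝕜 (localRep B A g j i) (B.chart j (f x)))
      (fderiv 𝕜 (localRep A B f i j) (A.chart i x)) := by
  have hgf : g (f x) = x := h.self_of_nhds
  have h1 : localRep B A g j i ∘ localRep A B f i j =ᶠ[𝓝 (A.chart i x)] id :=
    (localRep_comp_eventuallyEq hf.1 i hi hj).symm.trans
      ((localRep_congr h i hi).trans (localRep_id_eventuallyEq hi))
  have hf' := (hf.2 i j hi hj).differentiableAt
  have hg' := (hg.2 j i hj (by rwa [hgf])).differentiableAt
  have h2 := h1.fderiv_eq (𝕜 := 𝕜)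
  rw [fderiv_comp _ (by rwa [localRep_apply f j hi]) hf', localRep_apply f j hi, fderiv_id] at h2
  exact fun v => DFunLike.congr_fun h2 v

/-- By the chain rule, the derivative of the local retraction is the continuous left inverse sought.
-/
theorem isImmersion_of_retraction {f : M → N} (hf : IsAnalytic A B f)
    (h : ∀ x, ∃ g : N → M, IsAnalyticAt B A g (f x) ∧ g ∘ f =ᶠ[𝓝 x] id) :
    IsImmersion A B f := by
  refine ⟨hf, fun x i j hi hj => ?_⟩
  obtain ⟨g, hg, hgf⟩ := h x
  exact ⟨_, leftInverse_fderiv_localRep (hf x) hg hgf hi hj⟩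

/-- The chain rule again with the roles exchanged: the derivative of the section is the right
inverse. -/
theorem isSubmersion_of_section {f : M → N} (hf : IsAnalytic A B f)
    (h : ∀ x, ∃ g : N → M, IsAnalyticAt B A g (f x) ∧ g (f x) = x ∧ f ∘ g =ᶠ[𝓝 (f x)] id) :
    IsSubmersion A B f := by
  refine ⟨hf, fun x i j hi hj => ?_⟩
  obtain ⟨g, hg, hgx, hfg⟩ := h x
  have := leftInverse_fderiv_localRep hg (by rw [hgx]; exact hf x) hfg hj
    (by rwa [hgx] : _ ∈ (A.chart i).source)
  rw [hgx] at this
  exact ⟨_, this⟩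

/-! The charts of a manifold and maps between Banach spaces. -/

section Open

variable {V : Type u} [Nonempty M] [NormedAddCommGroup V] [NormedSpace 𝕜 V] [CompleteSpace V]

theorem isAnalytic_ofIsOpenEmbedding (f : M → V) (hf : IsOpenEmbedding f) :
    IsAnalytic (ofIsOpenEmbedding (𝕜 := 𝕜) f hf) (self V) f := by
  refine fun x => ⟨hf.continuous.continuousAt, fun _ _ _ _ => ?_⟩
  have hx : f x ∈ (hf.toOpenPartialHomeomorph f).target := by simp
  have key : AnalyticAt 𝕜 (fun y : V => f ((hf.toOpenPartialHomeomorph f).symm y)) (f x) := by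
    refine (analyticAt_id (𝕜 := 𝕜) (E := V)).congr ?_
    filter_upwards [(hf.toOpenPartialHomeomorph f).open_target.mem_nhds hx] with y hy
    exact ((hf.toOpenPartialHomeomorph f).right_inv hy).symm
  exact key

end Open

/-- The inverse of the chart of an open embedding comes from a choice, so even for the identity it
must be identified by hand. -/
theorem symm_toOpenPartialHomeomorph_id {V : Type u} [TopologicalSpace V] [Nonempty V] :
    ((IsOpenEmbedding.id.toOpenPartialHomeomorph (id : V → V)).symm : V → V) = id :=
  funext fun _ => IsOpenEmbedding.id.toOpenPartialHomeomorph_left_inv (id : V → V)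

section Self

variable {V W : Type u} [NormedAddCommGroup V] [NormedSpace 𝕜 V] [CompleteSpace V]
  [NormedAddCommGroup W] [NormedSpace 𝕜 W] [CompleteSpace W]

theorem isAnalyticAt_self {f : V → W} {x : V} (h : AnalyticAt 𝕜 f x) :
    IsAnalyticAt (self (𝕜 := 𝕜) V) (self W) f x := by
  refine ⟨h.continuousAt, fun _ _ _ _ => ?_⟩
  have key : AnalyticAt 𝕜
      (f ∘ (IsOpenEmbedding.id.toOpenPartialHomeomorph (id : V → V)).symm) x := by
    rwa [symm_toOpenPartialHomeomorph_id]
  exact key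

end Self

theorem isAnalyticAt_chart {i : A.Index} {x : M} (hi : x ∈ (A.chart i).source) :
    IsAnalyticAt A (self (A.Model i)) (A.chart i) x :=
  ⟨(A.chart i).continuousAt hi, fun _ _ hk _ => analyticAt_localRep_id hk hi⟩

theorem isAnalyticAt_chart_symm {i : A.Index} {y : A.Model i} (hy : y ∈ (A.chart i).target) :
    IsAnalyticAt (self (A.Model i)) A (A.chart i).symm y := by
  refine ⟨(A.chart i).symm.continuousAt hy, fun _ k _ hk => ?_⟩
  have key : AnalyticAt 𝕜 ((A.chart k ∘ (A.chart i).symm) ∘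
      (IsOpenEmbedding.id.toOpenPartialHomeomorph (id : A.Model i → A.Model i)).symm) y := by
    rw [symm_toOpenPartialHomeomorph_id]
    exact A.analytic_trans i k y (by
      rw [OpenPartialHomeomorph.trans_source]
      exact ⟨hy, hk⟩)
  exact key

/-- A map is analytic at `x` if it is, near `x`, a chart of the source followed by an analytic map
and the inverse of a chart of the target. -/
theorem isAnalyticAt_of_eventuallyEq {f : M → N} {x : M} {i : A.Index} {j : B.Index}
    (hi : x ∈ (A.chart i).source) {φ : A.Model i → B.Model j}
    (hφ : AnalyticAt 𝕜 φ (A.chart i x)) (hj : φ (A.chart i x) ∈ (B.chart j).target)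
    (h : f =ᶠ[𝓝 x] fun y => (B.chart j).symm (φ (A.chart i y))) : IsAnalyticAt A B f x :=
  (((isAnalyticAt_chart_symm hj).comp (isAnalyticAt_self hφ)).comp
    (isAnalyticAt_chart hi)).congr h.symm

/-! ### The structure induced by an open embedding -/

variable (B) in
/-- The analytic structure pulled back along an open embedding. -/
noncomputable def comap [Nonempty M] (f : M → N) (hf : IsOpenEmbedding f) :
    BanachStructure 𝕜 M where
  Index := B.Index
  Model := B.Model
  chart := fun i => (hf.toOpenPartialHomeomorph f).trans (B.chart i)
  exists_mem_source := fun x => by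
    obtain ⟨i, hi⟩ := B.exists_mem_source (f x)
    exact ⟨i, by simpa [OpenPartialHomeomorph.trans_source] using hi⟩
  analytic_trans := by
    intro i j y hy
    simp only [OpenPartialHomeomorph.trans_source, mem_inter_iff, mem_preimage,
      OpenPartialHomeomorph.symm_source,
      OpenPartialHomeomorph.trans_symm_eq_symm_trans_symm, OpenPartialHomeomorph.coe_trans,
      Function.comp_apply] at hy
    obtain ⟨⟨hy1, hy2⟩, -, hy3⟩ := hy
    have e : f ((hf.toOpenPartialHomeomorph f).symm ((B.chart i).symm y)) = (B.chart i).symm y :=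
      (hf.toOpenPartialHomeomorph f).right_inv hy2
    refine (B.analytic_trans i j y ?_).congr ?_
    · rw [OpenPartialHomeomorph.trans_source]
      refine ⟨hy1, ?_⟩
      rw [mem_preimage, ← e]
      exact hy3
    · have hc := (B.chart i).symm.continuousAt hy1
      filter_upwards [hc.tendsto.eventually
        ((hf.toOpenPartialHomeomorph f).open_target.mem_nhds hy2)] with z hz
      have := (hf.toOpenPartialHomeomorph f).right_inv hz
      exact congrArg (B.chart j) this.symm
  hausdorff := by
    have := B.hausdorff
    exact hf.toIsEmbedding.t2Space

/-- In charts, `f` is a coordinate change of `B`. -/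
theorem isAnalytic_comap [Nonempty M] (f : M → N) (hf : IsOpenEmbedding f) :
    IsAnalytic (comap B f hf) B f := by
  refine fun x => ⟨hf.continuous.continuousAt, fun (i : B.Index) j hi hj => ?_⟩
  have hi' : f x ∈ (B.chart i).source := hi.2
  have key : AnalyticAt 𝕜 (fun y : B.Model i => B.chart j
      (f ((hf.toOpenPartialHomeomorph f).symm ((B.chart i).symm y)))) (B.chart i (f x)) := by
    refine (B.analytic_trans i j _ ?_).congr ?_
    · rw [OpenPartialHomeomorph.trans_source]
      refine ⟨(B.chart i).map_source hi', ?_⟩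
      rwa [mem_preimage, (B.chart i).left_inv hi']
    · have hc := (B.chart i).symm.continuousAt ((B.chart i).map_source hi')
      rw [ContinuousAt, (B.chart i).left_inv hi'] at hc
      have hx : f x ∈ (hf.toOpenPartialHomeomorph f).target := by simp
      filter_upwards [hc.eventually
        ((hf.toOpenPartialHomeomorph f).open_target.mem_nhds hx)] with z hz
      exact congrArg (B.chart j) ((hf.toOpenPartialHomeomorph f).right_inv hz).symm
  exact key

/-- Maps into the pulled back structure. -/
theorem isAnalyticAt_comap_of_comp [Nonempty M] (f : M → N) (hf : IsOpenEmbedding f) {g : P → M}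
    {z : P} (hg : IsAnalyticAt C B (f ∘ g) z) : IsAnalyticAt C (comap B f hf) g z := by
  exact ⟨hf.isInducing.continuousAt_iff.2 hg.1, fun k i hk hi => hg.2 k i hk hi.2⟩

end Basic

/-! ### Local sections of submersions and local retractions of immersions -/

section Inverse

variable {𝕜 : Type w} [RCLike 𝕜]

/-- The inverse function theorem, with differentiability order `⊤` meaning analyticity. Derivative
the identity is enough, since below the maps are first composed with one-sided inverses of their
derivatives. -/
theorem exists_analyticAt_inverse {V : Type u} [NormedAddCommGroup V] [NormedSpace 𝕜 V]
    [CompleteSpace V] {f : V → V} {x : V} (hf : AnalyticAt 𝕜 f x)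
    (hf' : HasFDerivAt f (ContinuousLinearMap.id 𝕜 V) x) :
    ∃ g : V → V, AnalyticAt 𝕜 g (f x) ∧ g (f x) = x ∧ (∀ᶠ y in 𝓝 x, g (f y) = y) ∧
      ∀ᶠ y in 𝓝 (f x), f (g y) = y := by
  have h1 : ContDiffAt 𝕜 ⊤ f x := hf.contDiffAt
  have h2 : HasFDerivAt f ((ContinuousLinearEquiv.refl 𝕜 V : V ≃L[𝕜] V) : V →L[𝕜] V) x := hf'
  have h3 : HasStrictFDerivAt f ((ContinuousLinearEquiv.refl 𝕜 V : V ≃L[𝕜] V) : V →L[𝕜] V) x :=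
    h1.hasStrictFDerivAt' h2 (by simp)
  exact ⟨h3.localInverse f _ x, (h1.to_localInverse h2 (by simp)).analyticAt,
    h3.localInverse_apply_image, h3.eventually_left_inverse, h3.eventually_right_inverse⟩

variable {M N P : Type u} [TopologicalSpace M]
  [TopologicalSpace N] [TopologicalSpace P] {A : BanachStructure 𝕜 M} {B : BanachStructure 𝕜 N}
  {C : BanachStructure 𝕜 P}

/-- With `R` a right inverse of the derivative, the local representative restricted to the slice `a
+ R v` has derivative the identity. Inverting it gives the section. -/
theorem IsSubmersion.exists_section {f : M → N} (hf : IsSubmersion A B f) (x : M) :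
    ∃ g : N → M, IsAnalyticAt B A g (f x) ∧ g (f x) = x ∧ f ∘ g =ᶠ[𝓝 (f x)] id := by
  obtain ⟨i, hi⟩ := A.exists_mem_source x
  obtain ⟨j, hj⟩ := B.exists_mem_source (f x)
  obtain ⟨R, hR⟩ := hf.2 x i j hi hj
  have hF := (hf.1 x).2 i j hi hj
  set F := localRep A B f i j
  set a := A.chart i x
  have hFa : F a = B.chart j (f x) := localRep_apply f j hi
  let h : B.Model j → B.Model j := fun v => F (a + R v) - B.chart j (f x)
  have hF0 : AnalyticAt 𝕜 F (a + R 0) := by simpa using hF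
  have hh : AnalyticAt 𝕜 h 0 :=
    (hF0.comp (f := fun v => a + R v) (analyticAt_const.add (R.analyticAt 0))).sub analyticAt_const
  have hh' : HasFDerivAt h (ContinuousLinearMap.id 𝕜 (B.Model j)) 0 := by
    have h1 : HasFDerivAt (fun v => a + R v) R 0 := R.hasFDerivAt.const_add a
    have h2 : HasFDerivAt F (fderiv 𝕜 F a) (a + R 0) := by
      simpa using hF.differentiableAt.hasFDerivAt
    have h3 := (h2.comp (0 : B.Model j) h1).sub_const (B.chart j (f x))
    have h4 : (fderiv 𝕜 F a).comp R = ContinuousLinearMap.id 𝕜 (B.Model j) := by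
      ext v
      exact hR v
    rw [h4] at h3
    exact h3
  have hh0 : h 0 = 0 := by simp [h, hFa]
  obtain ⟨g, hg, hg0, -, hgr⟩ := exists_analyticAt_inverse hh hh'
  rw [hh0] at hg hg0 hgr
  let σ : B.Model j → A.Model i := fun v => a + R (g (v - B.chart j (f x)))
  have hσa : σ (B.chart j (f x)) = a := by simp [σ, hg0]
  have hσ : AnalyticAt 𝕜 σ (B.chart j (f x)) := by
    have hg' : AnalyticAt 𝕜 g (B.chart j (f x) - B.chart j (f x)) := by rwa [sub_self]
    have h1 := hg'.comp (f := fun v => v - B.chart j (f x)) (by fun_prop)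
    exact analyticAt_const.add ((R.analyticAt _).comp h1)
  let s : N → M := fun y => (A.chart i).symm (σ (B.chart j y))
  have hs : IsAnalyticAt B A s (f x) :=
    isAnalyticAt_of_eventuallyEq hj hσ (by rw [hσa]; exact (A.chart i).map_source hi) EventuallyEq.rfl
  have hsx : s (f x) = x := by
    simp only [s, hσa]
    exact (A.chart i).left_inv hi
  refine ⟨s, hs, hsx, ?_⟩
  have hcB : Tendsto (fun y => B.chart j y - B.chart j (f x)) (𝓝 (f x)) (𝓝 0) := by
    have := ((B.chart j).continuousAt hj).tendsto.sub_const (B.chart j (f x))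
    rwa [sub_self] at this
  -- Equality of coordinates yields `f (s y) = y` only if `f (s y)` stays in the chart domain, which
  -- continuity ensures.
  have hfs : ContinuousAt (f ∘ s) (f x) :=
    ContinuousAt.comp (by rw [hsx]; exact (hf.1 x).1) hs.1
  have hfs' : Tendsto (f ∘ s) (𝓝 (f x)) (𝓝 (f x)) := by
    have := hfs.tendsto
    rwa [Function.comp_apply, hsx] at this
  filter_upwards [hcB.eventually hgr, (B.chart j).open_source.mem_nhds hj,
    hfs'.eventually ((B.chart j).open_source.mem_nhds hj)] with y h1 h2 h3
  have h4 : B.chart j (f (s y)) = B.chart j y := by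
    have : F (a + R (g (B.chart j y - B.chart j (f x)))) = B.chart j y := by
      have := sub_eq_iff_eq_add.1 h1
      rw [this]; abel
    exact this
  exact (B.chart j).injOn h3 h2 h4

/-- Following the local representative by a left inverse `R` of its derivative gives a map with
derivative the identity. The retraction is `R` followed by the local inverse of that map. -/
theorem IsImmersion.exists_retraction {f : M → N} (hf : IsImmersion A B f) (x : M) :
    ∃ g : N → M, IsAnalyticAt B A g (f x) ∧ g ∘ f =ᶠ[𝓝 x] id := by
  obtain ⟨i, hi⟩ := A.exists_mem_source x
  obtain ⟨j, hj⟩ := B.exists_mem_source (f x)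
  obtain ⟨R, hR⟩ := hf.2 x i j hi hj
  have hF := (hf.1 x).2 i j hi hj
  set F := localRep A B f i j with hFdef
  set a := A.chart i x
  have hFa : F a = B.chart j (f x) := localRep_apply f j hi
  have hh : AnalyticAt 𝕜 (R ∘ F) a := (R.analyticAt _).comp hF
  have hh' : HasFDerivAt (R ∘ F) (ContinuousLinearMap.id 𝕜 (A.Model i)) a := by
    have h3 := R.hasFDerivAt.comp a hF.differentiableAt.hasFDerivAt
    have h4 : R.comp (fderiv 𝕜 F a) = ContinuousLinearMap.id 𝕜 (A.Model i) := by
      ext v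
      exact hR v
    rwa [h4] at h3
  obtain ⟨g, hg, hg0, hgl, -⟩ := exists_analyticAt_inverse hh hh'
  rw [Function.comp_apply, hFa] at hg hg0
  refine ⟨fun y => (A.chart i).symm (g (R (B.chart j y))), ?_, ?_⟩
  · refine isAnalyticAt_of_eventuallyEq (φ := fun v => g (R v)) hj
      (hg.comp (R.analyticAt _)) ?_ EventuallyEq.rfl
    rw [hg0]; exact (A.chart i).map_source hi
  · filter_upwards [((A.chart i).continuousAt hi).tendsto.eventually hgl,
      (A.chart i).open_source.mem_nhds hi] with y h1 h2
    rw [Function.comp_apply, hFdef, localRep_apply f j h2] at h1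
    exact (congrArg (A.chart i).symm h1).trans ((A.chart i).left_inv h2)

/-- A map on the target of a surjective submersion is analytic if its composition with the
submersion is. -/
theorem IsSubmersion.isAnalytic_of_comp {q : M → N} (hq : IsSubmersion A B q)
    (hs : Function.Surjective q) {f : N → P} (hf : IsAnalytic A C (f ∘ q)) : IsAnalytic B C f := by
  intro y
  obtain ⟨x, rfl⟩ := hs y
  obtain ⟨g, hg, hgx, hqg⟩ := hq.exists_section x
  refine ((hf x).comp_of_eq hg hgx).congr ?_
  filter_upwards [hqg] with z hz
  exact congrArg f hz

/-- A continuous map into the source of an immersion is analytic if its composition with the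
immersion is. -/
theorem IsImmersion.isAnalyticAt_of_comp {e : N → P} (he : IsImmersion B C e) {f : M → N} {x : M}
    (hc : ContinuousAt f x) (hf : IsAnalyticAt A C (e ∘ f) x) : IsAnalyticAt A B f x := by
  obtain ⟨g, hg, hge⟩ := he.exists_retraction (f x)
  refine (IsAnalyticAt.comp (f := e ∘ f) hg hf).congr ?_
  exact hc.tendsto.eventually hge

end Inverse

end BanachStructure

open BanachStructure

/-! ### Analytic maps into `GL X` and a criterion for Lie subgroups. -/

section GeneralLinear

variable {𝕜 : Type w} [NontriviallyNormedField 𝕜] {X : Type u} [NormedAddCommGroup X]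
  [NormedSpace 𝕜 X] [CompleteSpace X] {M : Type u} [TopologicalSpace M] {A : BanachStructure 𝕜 M}

theorem isAnalytic_val :
    IsAnalytic (glStructure 𝕜 X) (self (X →L[𝕜] X)) (Units.val : BanachGL 𝕜 X → X →L[𝕜] X) :=
  isAnalytic_ofIsOpenEmbedding _ _

/-- A map into `GL X` is analytic if it is so as a map into the space of operators. -/
theorem isAnalyticAt_gl_of_val {f : M → BanachGL 𝕜 X} {x : M}
    (hf : IsAnalyticAt A (self (X →L[𝕜] X)) (fun y => (f y : X →L[𝕜] X)) x) :
    IsAnalyticAt A (glStructure 𝕜 X) f x := by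
  let e := Units.isOpenEmbedding_val.toOpenPartialHomeomorph
    (Units.val : BanachGL 𝕜 X → X →L[𝕜] X)
  have h : IsAnalyticAt (self (X →L[𝕜] X)) (glStructure 𝕜 X) e.symm (f x) :=
    isAnalyticAt_chart_symm (A := glStructure 𝕜 X) (i := PUnit.unit) (e.map_source (mem_univ _))
  refine (h.comp_of_eq hf rfl).congr (Eventually.of_forall fun y => ?_)
  exact Units.isOpenEmbedding_val.toOpenPartialHomeomorph_left_inv _

theorem isAnalytic_mul_right (V : BanachGL 𝕜 X) :
    IsAnalytic (glStructure 𝕜 X) (glStructure 𝕜 X) (fun W => W * V) := by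
  intro W
  refine isAnalyticAt_gl_of_val ?_
  have h : AnalyticAt 𝕜 (fun T : X →L[𝕜] X => T * (V : X →L[𝕜] X)) (W : X →L[𝕜] X) :=
    analyticAt_id.mul analyticAt_const
  exact (isAnalyticAt_self h).comp (isAnalytic_val W)

/-- A subgroup of `GL X` consisting of the units of a complemented closed subalgebra of the algebra
of operators is a Banach Lie subgroup. -/
theorem isBanachLieSubgroup_of_subalgebra (H : Subgroup (BanachGL 𝕜 X))
    (S : Subalgebra 𝕜 (X →L[𝕜] X)) (hS : (Subalgebra.toSubmodule S).ClosedComplemented)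
    (hH : ∀ W : BanachGL 𝕜 X, W ∈ H ↔ (W : X →L[𝕜] X) ∈ S ∧ ((W⁻¹ : BanachGL 𝕜 X) : X →L[𝕜] X) ∈ S) :
    IsBanachLieSubgroup H := by
  have hclosed : IsClosed (S : Set (X →L[𝕜] X)) := hS.isClosed
  have : CompleteSpace S := hclosed.completeSpace_coe
  let f : H → S := fun W => ⟨(W : BanachGL 𝕜 X), ((hH W).1 W.2).1⟩
  have hemb : IsEmbedding f := by
    refine IsEmbedding.of_comp ?_ continuous_subtype_val ?_
    · exact Continuous.subtype_mk (Units.continuous_val.comp continuous_subtype_val) _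
    · exact Units.isOpenEmbedding_val.isEmbedding.comp IsEmbedding.subtypeVal
  -- Since membership in `H` controls both `W` and `W⁻¹`, the image is the unit group of the Banach
  -- algebra `S`, hence open.
  have hrange : range f = {T : S | IsUnit T} := by
    ext T
    constructor
    · rintro ⟨W, rfl⟩
      refine ⟨⟨f W, ⟨((W : BanachGL 𝕜 X)⁻¹ : BanachGL 𝕜 X), ((hH W).1 W.2).2⟩, ?_, ?_⟩, rfl⟩
      · exact Subtype.ext (W : BanachGL 𝕜 X).mul_inv
      · exact Subtype.ext (W : BanachGL 𝕜 X).inv_mul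
    · rintro ⟨T, rfl⟩
      exact ⟨⟨Units.map S.val.toMonoidHom T, (hH _).2 ⟨T.1.2, T.2.2⟩⟩, rfl⟩
  have hf : IsOpenEmbedding f := ⟨hemb, by rw [hrange]; exact Units.isOpen⟩
  let e := hf.toOpenPartialHomeomorph f
  have htarget : ∀ W, f W ∈ e.target := fun W => by simp [e]
  have hleft : ∀ W, e.symm (f W) = W := fun W => hf.toOpenPartialHomeomorph_left_inv f
  have hright : ∀ W, ∀ᶠ T in 𝓝 (f W), f (e.symm T) = T := fun W => by
    filter_upwards [e.open_target.mem_nhds (htarget W)] with T hT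
    exact e.right_inv hT
  let A : BanachStructure 𝕜 H := ofIsOpenEmbedding f hf
  have hval : ∀ W, IsAnalyticAt A (self (X →L[𝕜] X))
      (fun W : H => ((W : BanachGL 𝕜 X) : X →L[𝕜] X)) W :=
    fun W => (isAnalyticAt_self ((Subalgebra.toSubmodule S).subtypeL.analyticAt (f W))).comp
      (isAnalytic_ofIsOpenEmbedding f hf W)
  obtain ⟨p, hp⟩ := hS
  refine ⟨A, isImmersion_of_retraction (fun W => isAnalyticAt_gl_of_val (hval W)) fun W => ?_, ?_, ?_⟩
  · have h1 : IsAnalyticAt (self S) A e.symm (f W) :=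
      isAnalyticAt_chart_symm (A := A) (i := PUnit.unit) (htarget W)
    have hpf : ∀ V : H, p ((V : BanachGL 𝕜 X) : X →L[𝕜] X) = f V := fun V => hp (f V)
    -- The projection onto `S`, followed by the inverse of the chart, retracts `GL X` locally onto
    -- `H`.
    refine ⟨fun V => e.symm (p (V : X →L[𝕜] X)), ?_, ?_⟩
    · exact h1.comp_of_eq ((isAnalyticAt_self (p.analyticAt _)).comp
        (isAnalytic_val (W : BanachGL 𝕜 X))) (hpf W)
    · refine Eventually.of_forall fun V => ?_
      exact (congrArg e.symm (hpf V)).trans (hleft V)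
  · rintro ⟨V, W⟩
    refine ⟨continuous_mul.continuousAt, fun _ _ _ _ => ?_⟩
    -- In the single chart the group operations are, locally, multiplication and `Ring.inverse` of
    -- the algebra `S`.
    have key : AnalyticAt 𝕜 (fun q : S × S => f (e.symm q.1 * e.symm q.2)) (f V, f W) := by
      refine AnalyticAt.congr (f := fun q : S × S => q.1 * q.2) (analyticAt_fst.mul analyticAt_snd) ?_
      filter_upwards [(hright V).prod_nhds (hright W)] with q hq
      calc q.1 * q.2 = f (e.symm q.1) * f (e.symm q.2) := by rw [hq.1, hq.2]
        _ = _ := rfl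
    exact key
  · intro W
    refine ⟨continuous_inv.continuousAt, fun _ _ _ _ => ?_⟩
    have key : AnalyticAt 𝕜 (fun T : S => f (e.symm T)⁻¹) (f W) := by
      obtain ⟨U, hU⟩ : IsUnit (f W) := hrange.le ⟨W, rfl⟩
      have h1 := analyticAt_inverse (𝕜 := 𝕜) U
      rw [hU] at h1
      refine h1.congr ?_
      filter_upwards [hright W] with T hT
      have h2 : T * f (e.symm T)⁻¹ = 1 := by
        calc T * f (e.symm T)⁻¹ = f (e.symm T) * f (e.symm T)⁻¹ := by rw [hT]
          _ = 1 := Subtype.ext (e.symm T : BanachGL 𝕜 X).mul_inv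
      have h3 : f (e.symm T)⁻¹ * T = 1 := by
        calc f (e.symm T)⁻¹ * T = f (e.symm T)⁻¹ * f (e.symm T) := by rw [hT]
          _ = 1 := Subtype.ext (e.symm T : BanachGL 𝕜 X).inv_mul
      exact Ring.inverse_unit ⟨T, f (e.symm T)⁻¹, h2, h3⟩
    exact key

end GeneralLinear

/-! ### Actions with analytic orbit maps and local sections -/

theorem range_ofQuotientStabilizer (G : Type*) {Y : Type*} [Group G] [MulAction G Y] (y : Y) :
    range (MulAction.ofQuotientStabilizer G y) = MulAction.orbit G y := by
  ext z
  constructor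
  · rintro ⟨x, rfl⟩
    exact MulAction.ofQuotientStabilizer_mem_orbit _ _ _
  · rintro ⟨W, rfl⟩
    exact ⟨(W : G ⧸ MulAction.stabilizer G y), rfl⟩

section Orbits

variable {𝕜 : Type w} [RCLike 𝕜] {X : Type u} [NormedAddCommGroup X]
  [NormedSpace 𝕜 X] [CompleteSpace X] {Y : Type u} [TopologicalSpace Y]
  [MulAction (BanachGL 𝕜 X) Y]

/-- The orbit maps of the action of `GL X` on the manifold `Y` are analytic and have local analytic
sections. -/
structure HasAnalyticOrbits (B : BanachStructure 𝕜 Y) : Prop where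
  isAnalytic_smul : ∀ y : Y, IsAnalytic (glStructure 𝕜 X) B (fun W : BanachGL 𝕜 X => W • y)
  exists_section : ∀ y : Y, ∃ s : Y → BanachGL 𝕜 X, IsAnalyticAt B (glStructure 𝕜 X) s y ∧
    s y = 1 ∧ ∀ᶠ z in 𝓝 y, s z • y = z

namespace HasAnalyticOrbits

variable {B : BanachStructure 𝕜 Y}

theorem isOpen_orbit (h : HasAnalyticOrbits (X := X) B) (y : Y) :
    IsOpen (MulAction.orbit (BanachGL 𝕜 X) y) := by
  refine isOpen_iff_mem_nhds.2 fun z hz => ?_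
  obtain ⟨s, -, -, hs⟩ := h.exists_section z
  filter_upwards [hs] with t ht
  rw [← ht]
  exact MulAction.mem_orbit_of_mem_orbit _ hz

/-- The complement of an orbit is a union of other orbits, all of them open. -/
theorem isClopen_orbit (h : HasAnalyticOrbits (X := X) B) (y : Y) :
    IsClopen (MulAction.orbit (BanachGL 𝕜 X) y) := by
  refine ⟨⟨isOpen_iff_mem_nhds.2 fun z hz => ?_⟩, h.isOpen_orbit y⟩
  filter_upwards [(h.isOpen_orbit z).mem_nhds (MulAction.mem_orbit_self z)] with t ht hty
  apply hz
  rw [← MulAction.orbit_eq_iff] at ht hty ⊢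
  rw [← ht, hty]

/-- Right translation by `W` of the section at `W • y` moves its base point back to `y`. -/
theorem exists_section_apply (h : HasAnalyticOrbits (X := X) B) (y : Y) (W : BanachGL 𝕜 X) :
    ∃ s : Y → BanachGL 𝕜 X, IsAnalyticAt B (glStructure 𝕜 X) s (W • y) ∧
      s (W • y) = W ∧ ∀ᶠ z in 𝓝 (W • y), s z • y = z := by
  obtain ⟨s, hs, hs1, hsy⟩ := h.exists_section (W • y)
  refine ⟨fun z => s z * W, (isAnalytic_mul_right W _).comp hs, ?_, ?_⟩
  · simp [hs1]
  · filter_upwards [hsy] with z hz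
    rw [mul_smul, hz]

/-- Openness comes from the sections: a point `z` near `W • y` is the image of `[s z]`, which is
close to `[W]`. -/
theorem isOpenEmbedding_ofQuotientStabilizer (h : HasAnalyticOrbits (X := X) B) (y : Y) :
    IsOpenEmbedding (MulAction.ofQuotientStabilizer (BanachGL 𝕜 X) y) := by
  refine .of_continuous_injective_isOpenMap ?_ (MulAction.injective_ofQuotientStabilizer _ y) ?_
  · exact (QuotientGroup.isOpenQuotientMap_mk.isQuotientMap.continuous_iff).2
      (continuous_iff_continuousAt.2 fun W => (h.isAnalytic_smul y W).1)
  · refine IsOpenMap.of_nhds_le fun x => ?_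
    obtain ⟨W, rfl⟩ := QuotientGroup.mk_surjective x
    obtain ⟨s, hs, hsW, hsy⟩ := h.exists_section_apply y W
    intro U hU
    have hc : Tendsto (fun z => (s z : BanachGL 𝕜 X ⧸ MulAction.stabilizer (BanachGL 𝕜 X) y))
        (𝓝 (W • y)) (𝓝 (W : BanachGL 𝕜 X ⧸ MulAction.stabilizer (BanachGL 𝕜 X) y)) := by
      refine (QuotientGroup.continuous_mk.tendsto W).comp ?_
      have := hs.1.tendsto
      rwa [hsW] at this
    change U ∈ 𝓝 (W • y)
    filter_upwards [hc.eventually hU, hsy] with z h1 h2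
    have h3 : s z • y ∈ U := h1
    rwa [h2] at h3

/-- The structure is pulled back from `Y`. The section `s` composed with the embedding is then a
local section of the quotient map. -/
theorem exists_isHomogeneousStructure (h : HasAnalyticOrbits (X := X) B) (y : Y) :
    ∃ A, IsHomogeneousStructure (MulAction.stabilizer (BanachGL 𝕜 X) y) A := by
  have hemb := h.isOpenEmbedding_ofQuotientStabilizer y
  have : Nonempty (BanachGL 𝕜 X ⧸ MulAction.stabilizer (BanachGL 𝕜 X) y) := ⟨(1 : BanachGL 𝕜 X)⟩
  refine ⟨comap B _ hemb, isSubmersion_of_section (fun W => ?_) fun W => ?_⟩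
  · exact isAnalyticAt_comap_of_comp _ hemb (h.isAnalytic_smul y W)
  · obtain ⟨s, hs, hsW, hsy⟩ := h.exists_section_apply y W
    refine ⟨s ∘ MulAction.ofQuotientStabilizer (BanachGL 𝕜 X) y, ?_, hsW, ?_⟩
    · exact hs.comp_of_eq (isAnalytic_comap _ hemb _) rfl
    · filter_upwards [hemb.continuous.continuousAt.tendsto.eventually hsy] with z hz
      exact hemb.injective hz

theorem isAnalytic_ofQuotientStabilizer (h : HasAnalyticOrbits (X := X) B) (y : Y)
    {A : BanachStructure 𝕜 (BanachGL 𝕜 X ⧸ MulAction.stabilizer (BanachGL 𝕜 X) y)}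
    (hA : IsHomogeneousStructure _ A) :
    IsAnalytic A B (MulAction.ofQuotientStabilizer (BanachGL 𝕜 X) y) :=
  IsSubmersion.isAnalytic_of_comp hA QuotientGroup.mk_surjective (h.isAnalytic_smul y)

/-- Near a point of the orbit, `g` is the section followed by the quotient map. Its values off the
orbit play no role. -/
theorem isAnalyticAt_of_leftInverse (h : HasAnalyticOrbits (X := X) B) (y : Y)
    {A : BanachStructure 𝕜 (BanachGL 𝕜 X ⧸ MulAction.stabilizer (BanachGL 𝕜 X) y)}
    (hA : IsHomogeneousStructure _ A)
    {g : Y → BanachGL 𝕜 X ⧸ MulAction.stabilizer (BanachGL 𝕜 X) y}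
    (hg : Function.LeftInverse g (MulAction.ofQuotientStabilizer (BanachGL 𝕜 X) y)) {z : Y}
    (hz : z ∈ MulAction.orbit (BanachGL 𝕜 X) y) : IsAnalyticAt B A g z := by
  obtain ⟨W, rfl⟩ := hz
  obtain ⟨s, hs, hsW, hsy⟩ := h.exists_section_apply y W
  refine (IsAnalyticAt.comp (hA.1 _) hs).congr ?_
  filter_upwards [hsy] with t ht
  calc (s t : BanachGL 𝕜 X ⧸ MulAction.stabilizer (BanachGL 𝕜 X) y)
      = g (MulAction.ofQuotientStabilizer (BanachGL 𝕜 X) y (s t)) := (hg _).symm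
    _ = g t := congrArg g ht

theorem isBianalyticOnto_orbit (h : HasAnalyticOrbits (X := X) B) (y : Y)
    {A : BanachStructure 𝕜 (BanachGL 𝕜 X ⧸ MulAction.stabilizer (BanachGL 𝕜 X) y)}
    (hA : IsHomogeneousStructure _ A) :
    IsBianalyticOnto A B (MulAction.ofQuotientStabilizer (BanachGL 𝕜 X) y)
      (MulAction.orbit (BanachGL 𝕜 X) y) := by
  have : Nonempty (BanachGL 𝕜 X ⧸ MulAction.stabilizer (BanachGL 𝕜 X) y) := ⟨(1 : BanachGL 𝕜 X)⟩
  have hinv := Function.leftInverse_invFun (MulAction.injective_ofQuotientStabilizer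
    (BanachGL 𝕜 X) y)
  exact ⟨h.isOpen_orbit y, range_ofQuotientStabilizer _ y, h.isAnalytic_ofQuotientStabilizer y hA,
    _, hinv, fun z hz => h.isAnalyticAt_of_leftInverse y hA hinv hz⟩

end HasAnalyticOrbits

theorem exists_isOrbitTransversal (G : Type u) (Y : Type u) [Group G] [MulAction G Y] :
    ∃ R : Set Y, IsOrbitTransversal G R := by
  let r : Y → Y := fun y => (Quotient.mk (MulAction.orbitRel G Y) y).out
  have hr : ∀ y, r y ∈ MulAction.orbit G y := fun y =>
    MulAction.orbitRel_apply.1 (Quotient.mk_out (s := MulAction.orbitRel G Y) y)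
  -- The transversal is the set of chosen representatives of the orbit classes.
  refine ⟨range r, fun y => ⟨r y, ⟨mem_range_self y, MulAction.mem_orbit_symm.1 (hr y)⟩, ?_⟩⟩
  rintro _ ⟨⟨x, rfl⟩, hx⟩
  have h1 : MulAction.orbit G y = MulAction.orbit G x :=
    (MulAction.orbit_eq_iff.2 hx).trans (MulAction.orbit_eq_iff.2 (hr x))
  have h2 : y ∈ MulAction.orbit G x := h1 ▸ MulAction.mem_orbit_self y
  exact congrArg Quotient.out (Quotient.sound (s := MulAction.orbitRel G Y)
    (MulAction.orbitRel_apply.2 (MulAction.mem_orbit_symm.1 h2)))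

/-! ### Analytic maps into and out of disjoint unions. -/

section Sigma

variable {K : Type w} [NontriviallyNormedField K] {I : Type u} {M : I → Type u}
  [∀ k, TopologicalSpace (M k)] (A : ∀ k, BanachStructure K (M k)) {N : Type u}
  [TopologicalSpace N] {B : BanachStructure K N}

theorem isAnalyticAt_sigmaMk (k : I) (x : M k) :
    IsAnalyticAt (A k) (sigma A) (Sigma.mk k) x := by
  refine ⟨continuous_sigmaMk.continuousAt, ?_⟩
  rintro i ⟨l, j⟩ hi ⟨z, hz, hzx⟩
  -- A chart around a point of the `k`-th summand comes from that same summand.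
  obtain rfl : l = k := congrArg Sigma.fst hzx
  obtain rfl : z = x := by simpa using hzx
  have key : AnalyticAt K (fun y => (((A l).chart j).lift_openEmbedding IsOpenEmbedding.sigmaMk)
      (Sigma.mk l (((A l).chart i).symm y))) ((A l).chart i z) := by
    refine AnalyticAt.congr (analyticAt_localRep_id hi hz) (Eventually.of_forall fun y => ?_)
    exact (OpenPartialHomeomorph.lift_openEmbedding_apply _ IsOpenEmbedding.sigmaMk).symm
  exact key

theorem isAnalytic_sigma_desc {f : (Σ k, M k) → N}
    (hf : ∀ k, IsAnalytic (A k) B (fun x => f ⟨k, x⟩)) : IsAnalytic (sigma A) B f := by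
  rintro ⟨k, x⟩
  have hc : ContinuousAt f ⟨k, x⟩ := by
    rw [← IsOpenEmbedding.sigmaMk.continuousAt_iff]
    exact (hf k x).1
  refine ⟨hc, ?_⟩
  rintro ⟨l, i⟩ j ⟨z, hz, hzx⟩ hj
  obtain rfl : l = k := congrArg Sigma.fst hzx
  obtain rfl : z = x := by simpa using hzx
  have h1 : (((A l).chart i).lift_openEmbedding IsOpenEmbedding.sigmaMk) (Sigma.mk l z) =
      (A l).chart i z :=
    OpenPartialHomeomorph.lift_openEmbedding_apply _ IsOpenEmbedding.sigmaMk
  have key : AnalyticAt K (localRep (A l) B (fun x => f ⟨l, x⟩) i j)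
      ((((A l).chart i).lift_openEmbedding IsOpenEmbedding.sigmaMk) (Sigma.mk l z)) := by
    rw [h1]
    exact (hf l z).2 i j hz hj
  exact key

end Sigma

/-- The image of a point determines its orbit, hence its representative in `R`, hence its summand.
This reduces injectivity to a single quotient. -/
theorem HasAnalyticOrbits.isBianalyticOnto_sigma {B : BanachStructure 𝕜 Y}
    (h : HasAnalyticOrbits (X := X) B) {R : Set Y} (hR : IsOrbitTransversal (BanachGL 𝕜 X) R)
    (A : ∀ y : R, BanachStructure 𝕜 (BanachGL 𝕜 X ⧸ MulAction.stabilizer (BanachGL 𝕜 X) y.1))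
    (hA : ∀ y, IsHomogeneousStructure _ (A y)) :
    (sigma A).IsBianalyticOnto B
      (fun p => MulAction.ofQuotientStabilizer (BanachGL 𝕜 X) p.1.1 p.2) univ := by
  set f : (Σ y : R, BanachGL 𝕜 X ⧸ MulAction.stabilizer (BanachGL 𝕜 X) y.1) → Y :=
    fun p => MulAction.ofQuotientStabilizer (BanachGL 𝕜 X) p.1.1 p.2 with hf
  have hmem : ∀ p, f p ∈ MulAction.orbit (BanachGL 𝕜 X) p.1.1 := fun p =>
    MulAction.ofQuotientStabilizer_mem_orbit _ _ _
  have hsurj : Function.Surjective f := fun z => by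
    obtain ⟨y, ⟨hy, hz⟩, -⟩ := hR z
    obtain ⟨W, rfl⟩ := hz
    exact ⟨⟨⟨y, hy⟩, (W : BanachGL 𝕜 X ⧸ MulAction.stabilizer (BanachGL 𝕜 X) y)⟩, rfl⟩
  have hinj : Function.Injective f := by
    rintro ⟨y, a⟩ ⟨z, b⟩ hab
    have hyz : y = z := Subtype.ext ((hR (f ⟨y, a⟩)).unique ⟨y.2, hmem ⟨y, a⟩⟩
      ⟨z.2, by rw [hab]; exact hmem ⟨z, b⟩⟩)
    subst hyz
    exact congrArg _ (MulAction.injective_ofQuotientStabilizer _ _ hab)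
  let g := Function.surjInv hsurj
  have hgf : Function.LeftInverse g f := Function.leftInverse_surjInv ⟨hinj, hsurj⟩
  refine ⟨isOpen_univ, hsurj.range_eq, isAnalytic_sigma_desc A fun y =>
    h.isAnalytic_ofQuotientStabilizer y.1 (hA y), g, hgf, fun z _ => ?_⟩
  obtain ⟨⟨y, a⟩, rfl⟩ := hsurj z
  obtain ⟨-, -, -, k, hk, hka⟩ := h.isBianalyticOnto_orbit y.1 (hA y)
  refine ((isAnalyticAt_sigmaMk A y _).comp (hka _ (hmem ⟨y, a⟩))).congr ?_
  -- As the orbit is open, the global inverse agrees near the point with the inverse `k` for this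
  -- orbit followed by the inclusion of the summand.
  filter_upwards [(h.isOpen_orbit y.1).mem_nhds (hmem ⟨y, a⟩)] with t ht
  obtain ⟨W, rfl⟩ := ht
  have h1 : k (W • y.1) = W := hk (W : BanachGL 𝕜 X ⧸ MulAction.stabilizer (BanachGL 𝕜 X) y.1)
  exact (congrArg (Sigma.mk y) h1).trans (hgf ⟨y, W⟩).symm

end Orbits

/-! ### Submanifolds from local parametrizations -/

section Submanifold

variable {𝕜 : Type w} [NontriviallyNormedField 𝕜] {M V : Type u}
  [NormedAddCommGroup V] [NormedSpace 𝕜 V]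

variable (𝕜) in
/-- A local analytic parametrization `ψ` of the image of `e : M → V` around `e x`, with an analytic
left inverse `φ` defined on an open subset of `V`. -/
structure LocalParametrization (e : M → V) (x : M) where
  Model : Type u
  [normed : NormedAddCommGroup Model]
  [space : NormedSpace 𝕜 Model]
  [complete : CompleteSpace Model]
  source : Set V
  target : Set Model
  φ : V → Model
  ψ : Model → V
  isOpen_source : IsOpen source
  isOpen_target : IsOpen target
  mem_source : e x ∈ source
  analytic_φ : AnalyticOnNhd 𝕜 φ source
  analytic_ψ : AnalyticOnNhd 𝕜 ψ target
  map_source : ∀ y, e y ∈ source → φ (e y) ∈ target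
  map_target : ∀ v ∈ target, ψ v ∈ source ∩ range e
  left_inv : ∀ y, e y ∈ source → ψ (φ (e y)) = e y
  right_inv : ∀ v ∈ target, φ (ψ v) = v

attribute [instance] LocalParametrization.normed LocalParametrization.space
  LocalParametrization.complete

namespace LocalParametrization

variable {e : M → V}

theorem apply_invFun {x : M} (c : LocalParametrization 𝕜 e x) [Nonempty M] {v : c.Model}
    (hv : v ∈ c.target) : e (Function.invFun e (c.ψ v)) = c.ψ v :=
  Function.invFun_eq (c.map_target v hv).2

variable [TopologicalSpace M]

/-- The chart defined by a local parametrization. -/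
noncomputable def chart {x : M} (c : LocalParametrization 𝕜 e x) (he : IsEmbedding e) :
    OpenPartialHomeomorph M c.Model :=
  haveI : Nonempty M := ⟨x⟩
  { toFun := fun y => c.φ (e y)
    -- On the target, `ψ v` lies in the range of `e`, so this is its genuine preimage.
    invFun := fun v => Function.invFun e (c.ψ v)
    source := e ⁻¹' c.source
    target := c.target
    map_source' := c.map_source
    map_target' := fun v hv => by
      rw [mem_preimage, c.apply_invFun hv]
      exact (c.map_target v hv).1
    left_inv' := fun y hy => he.injective (by
      rw [c.apply_invFun (c.map_source y hy), c.left_inv y hy])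
    right_inv' := fun v hv => by rw [c.apply_invFun hv, c.right_inv v hv]
    open_source := c.isOpen_source.preimage he.continuous
    open_target := c.isOpen_target
    continuousOn_toFun := c.analytic_φ.continuousOn.comp he.continuous.continuousOn fun _ h => h
    continuousOn_invFun := by
      rw [he.isInducing.continuousOn_iff]
      exact c.analytic_ψ.continuousOn.congr fun v hv => c.apply_invFun hv }

theorem apply_chart_symm {x : M} (c : LocalParametrization 𝕜 e x) (he : IsEmbedding e)
    {v : c.Model} (hv : v ∈ c.target) : e ((c.chart he).symm v) = c.ψ v :=
  haveI : Nonempty M := ⟨x⟩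
  c.apply_invFun hv

/-- The manifold structure defined by local parametrizations around all points. -/
noncomputable def ofParametrizations (c : ∀ x, LocalParametrization 𝕜 e x) (he : IsEmbedding e) :
    BanachStructure 𝕜 M where
  Index := M
  Model := fun x => (c x).Model
  chart := fun x => (c x).chart he
  exists_mem_source := fun x => ⟨x, (c x).mem_source⟩
  analytic_trans := by
    intro x y v hv
    have hv1 : v ∈ (c x).target := hv.1
    have hv2 : e (((c x).chart he).symm v) ∈ (c y).source := hv.2
    rw [(c x).apply_chart_symm he hv1] at hv2
    refine AnalyticAt.congr (f := (c y).φ ∘ (c x).ψ)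
      (((c y).analytic_φ _ hv2).comp ((c x).analytic_ψ v hv1)) ?_
    filter_upwards [(c x).isOpen_target.mem_nhds hv1] with z hz
    exact congrArg (c y).φ ((c x).apply_chart_symm he hz).symm
  hausdorff := he.t2Space

/-- In its charts `e` is `ψ`, and `φ` followed by the inverse chart is a local retraction. -/
theorem isImmersion [CompleteSpace V] (c : ∀ x, LocalParametrization 𝕜 e x) (he : IsEmbedding e) :
    (ofParametrizations c he).IsImmersion (self V) e := by
  refine isImmersion_of_retraction (fun x => ?_) fun x => ?_
  · refine ⟨he.continuous.continuousAt, fun (i : M) _ hi _ => ?_⟩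
    have key : AnalyticAt 𝕜 (e ∘ ((c i).chart he).symm) ((c i).φ (e x)) := by
      have hx := (c i).map_source x hi
      refine ((c i).analytic_ψ _ hx).congr ?_
      filter_upwards [(c i).isOpen_target.mem_nhds hx] with z hz
      exact ((c i).apply_chart_symm he hz).symm
    exact key
  · have key : IsAnalyticAt (self (c x).Model) (ofParametrizations c he) ((c x).chart he).symm
        ((c x).φ (e x)) :=
      isAnalyticAt_chart_symm (A := ofParametrizations c he) (i := x)
        ((c x).map_source x (c x).mem_source)
    refine ⟨((c x).chart he).symm ∘ (c x).φ,
      key.comp (isAnalyticAt_self ((c x).analytic_φ _ (c x).mem_source)), ?_⟩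
    filter_upwards [((c x).chart he).open_source.mem_nhds (c x).mem_source] with y hy
    exact ((c x).chart he).left_inv hy

end LocalParametrization

end Submanifold

/-! ### Idempotents of a ring -/

section Idempotent

variable {R : Type*} [Ring R] {P Q : R}

/-- The block diagonal part of an element with respect to the idempotent `Q`. -/
def diagPart (Q B : R) : R := Q * B * Q + (1 - Q) * B * (1 - Q)

/-- The canonical element intertwining the idempotents `Q` and `P`. -/
def intertwiner (Q P : R) : R := P * Q + (1 - P) * (1 - Q)

/-- Both sides equal `P * Q`. When the intertwiner is invertible, it therefore conjugates `Q` into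
`P`. -/
theorem mul_intertwiner (hP : P * P = P) (hQ : Q * Q = Q) :
    P * intertwiner Q P = intertwiner Q P * Q := by
  have h1 : P * intertwiner Q P = P * P * Q + (P - P * P) * (1 - Q) := by
    unfold intertwiner; noncomm_ring
  have h2 : intertwiner Q P * Q = P * (Q * Q) + (1 - P) * (Q - Q * Q) := by
    unfold intertwiner; noncomm_ring
  rw [h1, h2, hP, hQ]
  simp

theorem intertwiner_self (hQ : Q * Q = Q) : intertwiner Q Q = 1 := by
  have : intertwiner Q Q = Q * Q + (1 - Q - (Q - Q * Q)) := by unfold intertwiner; noncomm_ring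
  rw [this, hQ]
  simp

theorem diagPart_one (hQ : Q * Q = Q) : diagPart Q 1 = 1 := by
  have : diagPart Q 1 = Q * Q + (1 - Q - (Q - Q * Q)) := by unfold diagPart; noncomm_ring
  rw [this, hQ]
  simp

theorem mul_diagPart (hQ : Q * Q = Q) (B : R) : Q * diagPart Q B = Q * B * Q := by
  have : Q * diagPart Q B = Q * Q * B * Q + (Q - Q * Q) * B * (1 - Q) := by
    unfold diagPart; noncomm_ring
  rw [this, hQ]
  simp

theorem diagPart_mul (hQ : Q * Q = Q) (B : R) : diagPart Q B * Q = Q * B * Q := by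
  have : diagPart Q B * Q = Q * B * (Q * Q) + (1 - Q) * B * (Q - Q * Q) := by
    unfold diagPart; noncomm_ring
  rw [this, hQ]
  simp

theorem commute_diagPart (hQ : Q * Q = Q) (B : R) : Commute Q (diagPart Q B) :=
  (mul_diagPart hQ B).trans (diagPart_mul hQ B).symm

/-- Right linearity over the commutant of `Q`. It allows an element to be normalized to diagonal
part `1` by dividing by its own diagonal part. -/
theorem diagPart_mul_of_commute {C : R} (hC : Commute Q C) (B : R) :
    diagPart Q (B * C) = diagPart Q B * C := by
  have hC' : Commute (1 - Q) C := (Commute.one_left C).sub_left hC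
  simp only [diagPart, add_mul, mul_assoc, hC.eq, hC'.eq]

theorem diagPart_of_commute (hQ : Q * Q = Q) {C : R} (hC : Commute Q C) : diagPart Q C = C := by
  simpa [diagPart_one hQ] using diagPart_mul_of_commute hC 1

theorem diagPart_diagPart (hQ : Q * Q = Q) (B : R) : diagPart Q (diagPart Q B) = diagPart Q B :=
  diagPart_of_commute hQ (commute_diagPart hQ B)

/-- The intertwiner recovers the conjugating element `S` up to a right factor commuting with `Q`. -/
theorem intertwiner_conj (S : Rˣ) :
    intertwiner Q (S * Q * (S⁻¹ : Rˣ)) = S * diagPart Q (S⁻¹ : Rˣ) := by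
  have h : (1 : R) = S * (S⁻¹ : Rˣ) := S.mul_inv.symm
  have : (1 : R) - S * Q * (S⁻¹ : Rˣ) = S * (1 - Q) * (S⁻¹ : Rˣ) := by
    rw [mul_sub, sub_mul, mul_one, ← h]
  rw [intertwiner, this, diagPart]
  noncomm_ring

end Idempotent

/-! ### The manifold of idempotents -/

section Idem

variable {𝕜 : Type w} [NontriviallyNormedField 𝕜]

section Algebra

variable {R : Type u} [NormedRing R] [NormedAlgebra 𝕜 R]

variable (𝕜) in
/-- The block diagonal part as a bounded operator. -/
noncomputable def diagPartL (Q : R) : R →L[𝕜] R :=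
  ContinuousLinearMap.mulLeftRight 𝕜 R Q Q + ContinuousLinearMap.mulLeftRight 𝕜 R (1 - Q) (1 - Q)

theorem diagPartL_apply (Q B : R) : diagPartL 𝕜 Q B = diagPart Q B := rfl

variable (𝕜) in
/-- The off-diagonal elements with respect to `Q`. -/
noncomputable abbrev offDiag (Q : R) : Submodule 𝕜 R := (diagPartL 𝕜 Q).toLinearMap.ker

variable (𝕜) in
/-- The off-diagonal part. -/
noncomputable def offDiagPart {Q : R} (hQ : Q * Q = Q) : R →L[𝕜] offDiag 𝕜 Q :=
  (ContinuousLinearMap.id 𝕜 R - diagPartL 𝕜 Q).codRestrict (offDiag 𝕜 Q) fun B => by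
    change diagPartL 𝕜 Q (B - diagPartL 𝕜 Q B) = 0
    rw [map_sub]
    simp only [diagPartL_apply, diagPart_diagPart hQ, sub_self]

theorem coe_offDiagPart {Q : R} (hQ : Q * Q = Q) (B : R) :
    (offDiagPart 𝕜 hQ B : R) = B - diagPart Q B :=
  congrArg (B - ·) (diagPartL_apply Q B)

theorem diagPart_coe_offDiag {Q : R} (T : offDiag 𝕜 Q) : diagPart Q (T : R) = 0 := by
  rw [← diagPartL_apply (𝕜 := 𝕜)]
  exact T.2

variable [CompleteSpace R]

/-- The local parametrization `T ↦ (1 + T) Q (1 + T)⁻¹` of the set of idempotents. -/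
theorem exists_offDiag_parametrization {Q : R} (hQ : Q * Q = Q) :
    ∃ (Ω : Set R) (O : Set (offDiag 𝕜 Q)) (φ : R → offDiag 𝕜 Q) (ψ : offDiag 𝕜 Q → R),
      IsOpen Ω ∧ IsOpen O ∧ Q ∈ Ω ∧ AnalyticOnNhd 𝕜 φ Ω ∧ AnalyticOnNhd 𝕜 ψ O ∧
      (∀ P ∈ Ω, P * P = P → φ P ∈ O ∧ ψ (φ P) = P) ∧
      ∀ T ∈ O, ψ T ∈ Ω ∧ φ (ψ T) = T ∧ ∃ S : Rˣ, ψ T = S * Q * (S⁻¹ : Rˣ) := by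
  let W : R → R := intertwiner Q
  let D : R → R := fun B => diagPart Q (W B)
  have hW : ∀ B, AnalyticAt 𝕜 W B := fun B =>
    (analyticAt_id.mul analyticAt_const).add ((analyticAt_const.sub analyticAt_id).mul
      analyticAt_const)
  have hD : ∀ B, AnalyticAt 𝕜 D B := fun B => by
    have := (diagPartL 𝕜 Q).analyticAt (W B) |>.comp (hW B)
    refine this.congr (Eventually.of_forall fun C => diagPartL_apply _ _)
  have hWc : Continuous W := continuous_iff_continuousAt.2 fun B => (hW B).continuousAt
  have hDc : Continuous D := continuous_iff_continuousAt.2 fun B => (hD B).continuousAt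
  have hinv : ∀ {B : R}, IsUnit B → AnalyticAt 𝕜 Ring.inverse B := by
    rintro _ ⟨U, rfl⟩
    exact analyticAt_inverse U
  let Ω : Set R := {B | IsUnit (W B)} ∩ {B | IsUnit (D B)}
  have hΩ : IsOpen Ω := (Units.isOpen.preimage hWc).inter (Units.isOpen.preimage hDc)
  -- On `Ω`, `W B` divided by its diagonal part `D B` has diagonal part `1`, so it is `1 + T` with
  -- `T` off-diagonal. This `T` is the coordinate.
  let φ : R → offDiag 𝕜 Q := fun B => offDiagPart 𝕜 hQ (W B * Ring.inverse (D B))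
  let ψ : offDiag 𝕜 Q → R := fun T => (1 + T) * Q * Ring.inverse (1 + (T : R))
  let O₁ : Set (offDiag 𝕜 Q) := {T | IsUnit (1 + (T : R))}
  have hO₁ : IsOpen O₁ := Units.isOpen.preimage (continuous_const.add continuous_subtype_val)
  have hadd : ∀ T, AnalyticAt 𝕜 (fun T : offDiag 𝕜 Q => 1 + (T : R)) T := fun T =>
    analyticAt_const.add ((offDiag 𝕜 Q).subtypeL.analyticAt T)
  have hψ : AnalyticOnNhd 𝕜 ψ O₁ := fun T hT =>
    ((hadd T).mul analyticAt_const).mul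
      (AnalyticAt.comp (g := Ring.inverse) (f := fun T : offDiag 𝕜 Q => 1 + (T : R))
        (hinv hT) (hadd T))
  have hφ : AnalyticOnNhd 𝕜 φ Ω := fun B hB =>
    ((offDiagPart 𝕜 hQ).analyticAt _).comp ((hW B).mul
      (AnalyticAt.comp (g := Ring.inverse) (f := D) (hinv hB.2) (hD B)))
  have hψS : ∀ (T : offDiag 𝕜 Q) (S : Rˣ), (S : R) = 1 + (T : R) → ψ T = S * Q * (S⁻¹ : Rˣ) :=
    fun T S hS => by
      simp only [ψ, ← hS, Ring.inverse_unit]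
  refine ⟨Ω, O₁ ∩ ψ ⁻¹' Ω, φ, ψ, hΩ, hψ.continuousOn.isOpen_inter_preimage hO₁ hΩ, ?_, hφ,
    fun T hT => hψ T hT.1, ?_, ?_⟩
  · have h1 : W Q = 1 := intertwiner_self hQ
    have h2 : D Q = 1 := by simp only [D, h1, diagPart_one hQ]
    exact ⟨by rw [mem_ofPred_eq, h1]; exact isUnit_one, by rw [mem_ofPred_eq, h2]; exact isUnit_one⟩
  · intro P hP hPP
    obtain ⟨⟨U, hU⟩, ⟨E, hE⟩⟩ := hP
    have hEQ : Commute Q E := by rw [hE]; exact commute_diagPart hQ _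
    have hEQ' : Commute Q (E⁻¹ : Rˣ) := hEQ.units_inv_right
    have h1 : (((U * E⁻¹ : Rˣ) : R)) = 1 + (φ P : R) := by
      rw [coe_offDiagPart, ← hE, Ring.inverse_unit, diagPart_mul_of_commute hEQ',
        show diagPart Q (W P) = E from hE.symm, E.mul_inv, ← hU]
      simp
    have h2 : ψ (φ P) = P := by
      -- Conjugating `Q` by `U * E⁻¹` is the same as conjugating by `U`, because `E` commutes with
      -- `Q`.
      rw [hψS _ _ h1]
      have h3 : P * U = U * Q := by rw [hU]; exact mul_intertwiner hPP hQ
      calc ((U * E⁻¹ : Rˣ) : R) * Q * ((U * E⁻¹ : Rˣ)⁻¹ : Rˣ)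
          = U * ((E⁻¹ : Rˣ) * Q) * E * (U⁻¹ : Rˣ) := by simp [mul_assoc]
        _ = U * (Q * (E⁻¹ : Rˣ)) * E * (U⁻¹ : Rˣ) := by rw [hEQ'.eq]
        _ = U * Q * (U⁻¹ : Rˣ) := by simp [mul_assoc]
        _ = P := by rw [← h3]; simp [mul_assoc]
    refine ⟨⟨⟨_, h1⟩, ?_⟩, h2⟩
    rw [mem_preimage, h2]
    exact ⟨⟨U, hU⟩, ⟨E, hE⟩⟩
  · rintro T ⟨⟨S, hS⟩, hT⟩
    have h1 := hψS T S hS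
    refine ⟨hT, ?_, S, h1⟩
    -- For `S = 1 + T` the diagonal part is `1`, so `D (ψ T)` is exactly the second factor here and
    -- the division returns `S`.
    have hWT : W (ψ T) = S * diagPart Q (S⁻¹ : Rˣ) := by
      rw [h1]; exact intertwiner_conj S
    have hS1 : diagPart Q (S : R) = 1 := by
      rw [hS, show diagPart Q (1 + (T : R)) = diagPart Q 1 + diagPart Q T by
        unfold diagPart; noncomm_ring, diagPart_one hQ, diagPart_coe_offDiag, add_zero]
    have hDT : D (ψ T) = diagPart Q (S⁻¹ : Rˣ) := by
      simp only [D, hWT]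
      rw [diagPart_mul_of_commute (commute_diagPart hQ _), hS1, one_mul]
    obtain ⟨E, hE⟩ := hT.2
    have h2 : W (ψ T) * Ring.inverse (D (ψ T)) = S := by
      rw [hWT, ← hDT, ← hE, Ring.inverse_unit, mul_assoc, E.mul_inv, mul_one]
    apply Subtype.ext
    rw [coe_offDiagPart, h2, hS1, hS]
    simp

end Algebra

variable {X : Type u} [NormedAddCommGroup X] [NormedSpace 𝕜 X]

theorem Idem.coe_smul (W : BanachGL 𝕜 X) (Q : Idem 𝕜 X) :
    (W • Q).1 = W * Q.1 * (W⁻¹ : BanachGL 𝕜 X) := rfl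

theorem Idem.isEmbedding_val : IsEmbedding (fun Q : Idem 𝕜 X => Q.1) := IsEmbedding.subtypeVal

theorem mem_stabilizer_idem {W : BanachGL 𝕜 X} {Q : Idem 𝕜 X} :
    W ∈ MulAction.stabilizer (BanachGL 𝕜 X) Q ↔ Commute Q.1 (W : X →L[𝕜] X) := by
  rw [MulAction.mem_stabilizer_iff]
  constructor
  · intro h
    have h1 : W * Q.1 * (W⁻¹ : BanachGL 𝕜 X) = Q.1 := congrArg Subtype.val h
    exact ((Units.mul_inv_eq_iff_eq_mul W).1 h1).symm
  · intro h
    exact Subtype.ext ((Units.mul_inv_eq_iff_eq_mul W).2 h.eq.symm)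

variable [CompleteSpace X]

theorem exists_isSubmanifoldStructure :
    ∃ I : BanachStructure 𝕜 (Idem 𝕜 X), IsSubmanifoldStructure I := by
  have c : ∀ Q : Idem 𝕜 X, Nonempty (LocalParametrization 𝕜 (fun Q : Idem 𝕜 X => Q.1) Q) := by
    intro Q
    obtain ⟨Ω, O, φ, ψ, hΩ, hO, hQ, hφ, hψ, h1, h2⟩ :=
      exists_offDiag_parametrization (𝕜 := 𝕜) Q.2.1
    have : CompleteSpace (offDiag 𝕜 Q.1) :=
      (ContinuousLinearMap.isClosed_ker (diagPartL 𝕜 Q.1)).completeSpace_coe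
    exact ⟨{
      Model := offDiag 𝕜 Q.1
      source := Ω
      target := O
      φ := φ
      ψ := ψ
      isOpen_source := hΩ
      isOpen_target := hO
      mem_source := hQ
      analytic_φ := hφ
      analytic_ψ := hψ
      map_source := fun P hP => (h1 _ hP P.2.1).1
      map_target := fun T hT => ⟨(h2 T hT).1, by
        obtain ⟨S, hS⟩ := (h2 T hT).2.2
        exact ⟨S • Q, hS.symm⟩⟩
      left_inv := fun P hP => (h1 _ hP P.2.1).2
      right_inv := fun T hT => (h2 T hT).2.1 }⟩
  exact ⟨_, LocalParametrization.isImmersion (fun Q => (c Q).some) Idem.isEmbedding_val⟩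

/-- The subalgebra is the commutant of `Q`, and taking the diagonal part projects onto it. -/
theorem isBanachLieSubgroup_stabilizer_idem (Q : Idem 𝕜 X) :
    IsBanachLieSubgroup (MulAction.stabilizer (BanachGL 𝕜 X) Q) := by
  have hmem : ∀ T : X →L[𝕜] X, T ∈ Subalgebra.centralizer 𝕜 {Q.1} ↔ Commute Q.1 T := fun T => by
    rw [Subalgebra.mem_centralizer_iff]
    simp [Commute, SemiconjBy]
  refine isBanachLieSubgroup_of_subalgebra _ (Subalgebra.centralizer 𝕜 {Q.1}) ?_ fun W => ?_
  · refine ⟨(diagPartL 𝕜 Q.1).codRestrict _ fun T => (hmem _).2 ?_, fun T => Subtype.ext ?_⟩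
    · rw [diagPartL_apply]
      exact commute_diagPart Q.2.1 T
    · exact (diagPartL_apply _ _).trans (diagPart_of_commute Q.2.1 ((hmem _).1 T.2))
  · rw [mem_stabilizer_idem, hmem, hmem]
    exact ⟨fun h => ⟨h, h.units_inv_right⟩, fun h => h.1⟩

end Idem

/-- Conjugation is analytic into the operators, hence into the idempotents by the immersion
property. The section at `Q` is the intertwiner of `Q` and `P`. -/
theorem hasAnalyticOrbits_idem {𝕜 : Type w} [RCLike 𝕜] {X : Type u} [NormedAddCommGroup X]
    [NormedSpace 𝕜 X] [CompleteSpace X] {I : BanachStructure 𝕜 (Idem 𝕜 X)}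
    (hI : IsSubmanifoldStructure I) : HasAnalyticOrbits (X := X) I := by
  constructor
  · intro Q W
    have h1 : AnalyticAt 𝕜 (fun T : X →L[𝕜] X => T * Q.1 * Ring.inverse T) W :=
      (analyticAt_id.mul analyticAt_const).mul (analyticAt_inverse W)
    have h2 : IsAnalyticAt (glStructure 𝕜 X) (self (X →L[𝕜] X))
        (fun V : BanachGL 𝕜 X => (V • Q).1) W := by
      refine ((isAnalyticAt_self h1).comp (isAnalytic_val W)).congr
        (Eventually.of_forall fun V => ?_)
      simp only [Function.comp_apply, Ring.inverse_unit]
      rfl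
    exact hI.isAnalyticAt_of_comp (Idem.isEmbedding_val.isInducing.continuousAt_iff.2 h2.1) h2
  · intro Q
    let e := Units.isOpenEmbedding_val.toOpenPartialHomeomorph
      (Units.val : BanachGL 𝕜 X → X →L[𝕜] X)
    have h1 : intertwiner Q.1 Q.1 = ((1 : BanachGL 𝕜 X) : X →L[𝕜] X) := intertwiner_self Q.2.1
    have he : IsAnalyticAt (self (X →L[𝕜] X)) (glStructure 𝕜 X) e.symm (intertwiner Q.1 Q.1) := by
      rw [h1]
      exact isAnalyticAt_chart_symm (A := glStructure 𝕜 X) (i := PUnit.unit)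
        (e.map_source (mem_univ (1 : BanachGL 𝕜 X)))
    have hW : AnalyticAt 𝕜 (intertwiner Q.1) Q.1 :=
      (analyticAt_id.mul analyticAt_const).add ((analyticAt_const.sub analyticAt_id).mul
        analyticAt_const)
    have hWI : IsAnalyticAt I (self (X →L[𝕜] X)) (fun P : Idem 𝕜 X => intertwiner Q.1 P.1) Q :=
      (isAnalyticAt_self hW).comp (hI.1 Q)
    -- `e.symm` reads an invertible operator as a unit. Its value elsewhere is irrelevant, since the
    -- intertwiner is invertible for `P` near `Q`.
    refine ⟨fun P => e.symm (intertwiner Q.1 P.1),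
      IsAnalyticAt.comp (f := fun P : Idem 𝕜 X => intertwiner Q.1 P.1) he hWI,
      ?_, ?_⟩
    · simp only [h1]
      exact Units.isOpenEmbedding_val.toOpenPartialHomeomorph_left_inv _
    · have hunit : ∀ᶠ P : Idem 𝕜 X in 𝓝 Q, IsUnit (intertwiner Q.1 P.1) :=
        hWI.1.tendsto.eventually (Units.isOpen.mem_nhds (by rw [h1]; exact Units.isUnit _))
      filter_upwards [hunit] with P ⟨U, hU⟩
      have h2 : e.symm (intertwiner Q.1 P.1) = U := by
        rw [← hU]
        exact Units.isOpenEmbedding_val.toOpenPartialHomeomorph_left_inv _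
      rw [h2]
      apply Subtype.ext
      rw [Idem.coe_smul, Units.mul_inv_eq_iff_eq_mul, hU]
      exact (mul_intertwiner P.2.1 Q.2.1).symm

/-! ### The action on the Grassmann manifold -/

section Grassmann

variable {𝕜 : Type w} [NontriviallyNormedField 𝕜] {X : Type u} [NormedAddCommGroup X]
  [NormedSpace 𝕜 X]

theorem Grassmannian.coe_smul (W : BanachGL 𝕜 X) (E : Grassmannian 𝕜 X) :
    (W • E).1 = E.1.map (W : X →L[𝕜] X).toLinearMap := rfl

theorem kappa_smul (W : BanachGL 𝕜 X) (Q : Idem 𝕜 X) : kappa (W • Q) = W • kappa Q := by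
  apply Subtype.ext
  ext x
  constructor
  · rintro ⟨y, rfl⟩
    exact ⟨_, ⟨((W⁻¹ : BanachGL 𝕜 X) : X →L[𝕜] X) y, rfl⟩, rfl⟩
  · rintro ⟨_, ⟨y, rfl⟩, rfl⟩
    refine ⟨(W : X →L[𝕜] X) y, ?_⟩
    have h : ((W⁻¹ : BanachGL 𝕜 X) : X →L[𝕜] X) ((W : X →L[𝕜] X) y) = y :=
      DFunLike.congr_fun W.inv_mul y
    exact congrArg (fun z => (W : X →L[𝕜] X) (Q.1 z)) h

/-- The condition on `W⁻¹` is needed: in infinite dimension an invertible operator may map `E` into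
a proper subspace of `E`. -/
theorem mem_stabilizer_grassmannian {W : BanachGL 𝕜 X} {E : Grassmannian 𝕜 X} :
    W ∈ MulAction.stabilizer (BanachGL 𝕜 X) E ↔ (∀ x ∈ E.1, (W : X →L[𝕜] X) x ∈ E.1) ∧
      ∀ x ∈ E.1, ((W⁻¹ : BanachGL 𝕜 X) : X →L[𝕜] X) x ∈ E.1 := by
  have key : ∀ V : BanachGL 𝕜 X, V • E = E → ∀ x ∈ E.1, (V : X →L[𝕜] X) x ∈ E.1 :=
    fun V hV x hx => (congrArg Subtype.val hV).le (Submodule.mem_map_of_mem hx)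
  rw [MulAction.mem_stabilizer_iff]
  constructor
  · exact fun h => ⟨key W h, key W⁻¹ (inv_smul_eq_iff.2 h.symm)⟩
  · rintro ⟨h1, h2⟩
    apply Subtype.ext
    refine le_antisymm ?_ fun x hx => ⟨_, h2 x hx, DFunLike.congr_fun W.mul_inv x⟩
    rintro _ ⟨x, hx, rfl⟩
    exact h1 x hx

/-- The algebra of operators leaving a subspace invariant. -/
def invariantSubalgebra (E : Submodule 𝕜 X) : Subalgebra 𝕜 (X →L[𝕜] X) where
  carrier := {T | ∀ x ∈ E, T x ∈ E}
  mul_mem' hS hT x hx := hS _ (hT x hx)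
  add_mem' hS hT x hx := E.add_mem (hS x hx) (hT x hx)
  algebraMap_mem' c _ hx := E.smul_mem c hx

/-- With `P` a projection onto `E`, the map `T ↦ T - (1 - P) T P` removes the block leading from `E`
to its complement, and fixes `T` when that block vanishes. -/
theorem closedComplemented_invariantSubalgebra {E : Submodule 𝕜 X} (hE : E.ClosedComplemented) :
    (Subalgebra.toSubmodule (invariantSubalgebra E)).ClosedComplemented := by
  obtain ⟨p, hp⟩ := hE
  let P : X →L[𝕜] X := E.subtypeL ∘L p
  have hP : ∀ x ∈ E, P x = x := fun x hx => congrArg Subtype.val (hp ⟨x, hx⟩)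
  let Φ : (X →L[𝕜] X) →L[𝕜] (X →L[𝕜] X) :=
    ContinuousLinearMap.id 𝕜 _ - ContinuousLinearMap.mulLeftRight 𝕜 (X →L[𝕜] X) (1 - P) P
  have hΦ : ∀ T x, Φ T x = T x - (T (P x) - P (T (P x))) := fun T x => rfl
  refine ⟨Φ.codRestrict _ fun T x hx => ?_, fun T => Subtype.ext ?_⟩
  · rw [hΦ, hP x hx, sub_sub_cancel]
    exact (p _).2
  · refine ContinuousLinearMap.ext fun x => ?_
    have h : P (T.1 (P x)) = T.1 (P x) := hP _ (T.2 _ (p x).2)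
    exact (hΦ T.1 x).trans (by rw [h, sub_self, sub_zero])

variable [CompleteSpace X]

theorem isBanachLieSubgroup_stabilizer_grassmannian (E : Grassmannian 𝕜 X) :
    IsBanachLieSubgroup (MulAction.stabilizer (BanachGL 𝕜 X) E) :=
  isBanachLieSubgroup_of_subalgebra _ (invariantSubalgebra E.1)
    (closedComplemented_invariantSubalgebra E.2.2.2) fun _ => mem_stabilizer_grassmannian

/-- The component in the first member of `j` of an operator restricted to `E`. -/
noncomputable def fstPart (E : Grassmannian 𝕜 X) (j : ComplPair 𝕜 X) (T : X →L[𝕜] X) :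
    E.1 →L[𝕜] j.1.1.1 :=
  (j.1.1.1).projectionOntoL j.1.2.1 (Grassmannian.isTopCompl j.2) ∘L T ∘L E.1.subtypeL

/-- The component in the second member of `j` of an operator restricted to `E`. -/
noncomputable def sndPart (E : Grassmannian 𝕜 X) (j : ComplPair 𝕜 X) (T : X →L[𝕜] X) :
    E.1 →L[𝕜] j.1.2.1 :=
  (j.1.2.1).projectionOntoL j.1.1.1 (Grassmannian.isTopCompl j.2).symm ∘L T ∘L E.1.subtypeL

theorem fstPart_add_sndPart (E : Grassmannian 𝕜 X) (j : ComplPair 𝕜 X) (T : X →L[𝕜] X) (e : E.1) :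
    (fstPart E j T e : X) + sndPart E j T e = T e :=
  Submodule.projectionL_add_projectionL_eq_self (Grassmannian.isTopCompl j.2) (T e)

/-- The coordinates of `W(E)`. -/
theorem smul_eq_param {E : Grassmannian 𝕜 X} {j : ComplPair 𝕜 X} {W : BanachGL 𝕜 X}
    (h : (fstPart E j W).IsInvertible) :
    W • E = param j (sndPart E j W ∘L (fstPart E j W).inverse) := by
  obtain ⟨A, hA⟩ := h
  have hAe : ∀ e, A e = fstPart E j W e := fun e => by rw [← hA]; rfl
  rw [← hA, ContinuousLinearMap.inverse_equiv]
  -- Parametrizing `W(E)` by the first component `A e` instead of `e` exhibits it as a graph.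
  have key : ∀ e : E.1, (A e : X) + sndPart E j W (A.symm (A e)) = (W : X →L[𝕜] X) e := fun e => by
    rw [A.symm_apply_apply, hAe]
    exact fstPart_add_sndPart E j W e
  apply Subtype.ext
  refine le_antisymm ?_ ?_
  · rintro _ ⟨e, he, rfl⟩
    exact ⟨A ⟨e, he⟩, key ⟨e, he⟩⟩
  · rintro _ ⟨x, rfl⟩
    refine ⟨A.symm x, (A.symm x).2, ?_⟩
    have := key (A.symm x)
    rw [A.apply_symm_apply] at this
    exact this.symm

/-- Here the first component is `W` itself as a bijection from `E` onto `W(E)`, and the open mapping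
theorem applies. -/
theorem isInvertible_fstPart {E : Grassmannian 𝕜 X} {j : ComplPair 𝕜 X} {W : BanachGL 𝕜 X}
    (hj : j.1.1 = W • E) : (fstPart E j W).IsInvertible := by
  have hc := Grassmannian.isTopCompl j.2
  have hmem : ∀ e : E.1, (W : X →L[𝕜] X) e ∈ j.1.1.1 := fun e => by
    rw [hj]; exact Submodule.mem_map_of_mem e.2
  have hfst : ∀ e : E.1, fstPart E j W e = ⟨(W : X →L[𝕜] X) e, hmem e⟩ := fun e =>
    Submodule.projectionOntoL_apply_left hc ⟨_, hmem e⟩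
  have hW : ∀ x, ((W⁻¹ : BanachGL 𝕜 X) : X →L[𝕜] X) ((W : X →L[𝕜] X) x) = x := fun x =>
    DFunLike.congr_fun W.inv_mul x
  have hinj : Function.Injective (fstPart E j W) := by
    intro e e' h
    rw [hfst, hfst] at h
    have h' := congrArg (fun x : j.1.1.1 => ((W⁻¹ : BanachGL 𝕜 X) : X →L[𝕜] X) x) h
    simp only [hW] at h'
    exact Subtype.ext h'
  have hsurj : Function.Surjective (fstPart E j W) := by
    rintro ⟨x, hx⟩
    have hx' := hx
    rw [hj] at hx'
    obtain ⟨e, he, rfl⟩ := hx'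
    exact ⟨⟨e, he⟩, hfst ⟨e, he⟩⟩
  exact ⟨ContinuousLinearEquiv.ofBijective (fstPart E j W) (LinearMap.ker_eq_bot.2 hinj)
    (LinearMap.range_eq_top.2 hsurj), ContinuousLinearEquiv.coe_ofBijective _ _ _⟩

/-- In a chart centred at `W(E)`, the first component stays invertible near `W`. The coordinate is
the second component composed with the inverse of the first. -/
theorem isAnalytic_smul_grassmannian (E : Grassmannian 𝕜 X) :
    IsAnalytic (glStructure 𝕜 X) (grassmannStructure 𝕜 X) (fun W : BanachGL 𝕜 X => W • E) := by
  intro W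
  obtain ⟨j, hj⟩ := exists_complPair (W • E)
  have hinv := isInvertible_fstPart hj
  have h1 : ContDiff 𝕜 ⊤ (fstPart E j) := by unfold fstPart; fun_prop
  have h2 : ContDiff 𝕜 ⊤ (sndPart E j) := by unfold sndPart; fun_prop
  have h3 : ContDiffAt 𝕜 ⊤ (fun T => (fstPart E j T).inverse) (W : X →L[𝕜] X) :=
    (hinv.contDiffAt_map_inverse).comp (W : X →L[𝕜] X) h1.contDiffAt
  have h4 : AnalyticAt 𝕜 (fun T => sndPart E j T ∘L (fstPart E j T).inverse) (W : X →L[𝕜] X) :=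
    (h2.contDiffAt.clm_comp h3).analyticAt
  have h5 : IsAnalyticAt (self _) (grassmannStructure 𝕜 X) (param j)
      (sndPart E j W ∘L (fstPart E j W).inverse) :=
    isAnalyticAt_chart_symm (A := grassmannStructure 𝕜 X) (i := j) (mem_univ _)
  have h6 := (IsAnalyticAt.comp (f := fun T => sndPart E j T ∘L (fstPart E j T).inverse) h5
    (isAnalyticAt_self h4)).comp (isAnalytic_val W)
  refine h6.congr ?_
  have ho : IsOpen {A : E.1 →L[𝕜] j.1.1.1 | A.IsInvertible} :=
    ContinuousLinearEquiv.isOpen (𝕜 := 𝕜) (E := E.1) (F := j.1.1.1)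
  filter_upwards [(ho.preimage (h1.continuous.comp Units.continuous_val)).mem_nhds hinv] with V hV
  exact (smul_eq_param hV).symm

/-- The operator `I + T`, which maps `E` onto the graph of `T : E → F`. -/
noncomputable def shear (i : ComplPair 𝕜 X) (T : i.1.1.1 →L[𝕜] i.1.2.1) : X →L[𝕜] X :=
  1 + (i.1.2.1).subtypeL ∘L T ∘L
    (i.1.1.1).projectionOntoL i.1.2.1 (Grassmannian.isTopCompl i.2)

theorem shear_apply (i : ComplPair 𝕜 X) (T : i.1.1.1 →L[𝕜] i.1.2.1) (x : X) :
    shear i T x =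
      x + T ((i.1.1.1).projectionOntoL i.1.2.1 (Grassmannian.isTopCompl i.2) x) := rfl

/-- Extended by zero on `F`, the operators `S` and `T` take values in `F`, so their product
vanishes. -/
theorem shear_mul_shear (i : ComplPair 𝕜 X) (S T : i.1.1.1 →L[𝕜] i.1.2.1) :
    shear i S * shear i T = shear i (S + T) := by
  ext x
  change shear i S (shear i T x) = _
  simp only [shear_apply, map_add, Submodule.projectionOntoL_apply_right, add_zero,
    map_zero, _root_.add_apply, Submodule.coe_add, Submodule.coe_zero]
  abel

theorem shear_zero (i : ComplPair 𝕜 X) : shear i 0 = 1 := by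
  ext x
  simp [shear_apply]

/-- The operator `I + T` as an element of the general linear group. -/
noncomputable def shearUnit (i : ComplPair 𝕜 X) (T : i.1.1.1 →L[𝕜] i.1.2.1) : BanachGL 𝕜 X where
  val := shear i T
  inv := shear i (-T)
  val_inv := by rw [shear_mul_shear, add_neg_cancel, shear_zero]
  inv_val := by rw [shear_mul_shear, neg_add_cancel, shear_zero]

theorem shearUnit_smul (i : ComplPair 𝕜 X) (T : i.1.1.1 →L[𝕜] i.1.2.1) :
    shearUnit i T • i.1.1 = param i T := by
  have key : ∀ e : i.1.1.1, shear i T e = e + T e := fun e => by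
    rw [shear_apply, Submodule.projectionOntoL_apply_left]
  apply Subtype.ext
  refine le_antisymm ?_ ?_
  · rintro _ ⟨e, he, rfl⟩
    exact ⟨⟨e, he⟩, (key ⟨e, he⟩).symm⟩
  · rintro _ ⟨e, rfl⟩
    exact ⟨e, e.2, key e⟩

/-- The section sends `G` to `I + T` with `T` the coordinate of `G`. It is analytic because the
shear is affine in `T`. -/
theorem hasAnalyticOrbits_grassmannian {𝕜 : Type w} [RCLike 𝕜] {X : Type u} [NormedAddCommGroup X]
    [NormedSpace 𝕜 X] [CompleteSpace X] :
    HasAnalyticOrbits (X := X) (grassmannStructure 𝕜 X) := by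
  refine ⟨isAnalytic_smul_grassmannian, fun E => ?_⟩
  obtain ⟨i, rfl⟩ := exists_complPair E
  have h1 : AnalyticAt 𝕜 (shear i) (coord i i.1.1) := by
    apply ContDiffAt.analyticAt
    unfold shear
    fun_prop
  have h2 : IsAnalyticAt (grassmannStructure 𝕜 X) (self _) (coord i) i.1.1 :=
    isAnalyticAt_chart (A := grassmannStructure 𝕜 X) (i := i) i.2
  refine ⟨fun G => shearUnit i (coord i G),
    isAnalyticAt_gl_of_val ((isAnalyticAt_self h1).comp h2), ?_, ?_⟩
  · have h0 : coord i i.1.1 = 0 := coord_eq i i.2 0 fun e => by simp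
    apply Units.ext
    simp only [h0]
    exact shear_zero i
  · filter_upwards [(grassmannChart i).open_source.mem_nhds i.2] with G hG
    rw [shearUnit_smul, param_coord i hG]

end Grassmann

end BanachHomog

theorem mainTheorem8 {𝕜 : Type w} [RCLike 𝕜] {X : Type u} [NormedAddCommGroup X]
    [NormedSpace 𝕜 X] [CompleteSpace X] :
    -- the set of idempotents is a submanifold of the space of bounded operators
    (∃ I : BanachStructure 𝕜 (Idem 𝕜 X),
      IsSubmanifoldStructure I) ∧
    ∀ I : BanachStructure 𝕜 (Idem 𝕜 X),
      IsSubmanifoldStructure I →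
      -- stabilizers and orbits of idempotents
      (∀ Q : Idem 𝕜 X,
        IsBanachLieSubgroup (MulAction.stabilizer (BanachGL 𝕜 X) Q) ∧
        IsClopen (MulAction.orbit (BanachGL 𝕜 X) Q) ∧
        (∃ A, IsHomogeneousStructure
          (MulAction.stabilizer (BanachGL 𝕜 X) Q) A) ∧
        ∀ A, IsHomogeneousStructure
            (MulAction.stabilizer (BanachGL 𝕜 X) Q) A →
          A.IsBianalyticOnto I (MulAction.ofQuotientStabilizer (BanachGL 𝕜 X) Q)
            (MulAction.orbit (BanachGL 𝕜 X) Q)) ∧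
      -- stabilizers and orbits of complemented subspaces
      (∀ E : Grassmannian 𝕜 X,
        IsBanachLieSubgroup (MulAction.stabilizer (BanachGL 𝕜 X) E) ∧
        IsClopen (MulAction.orbit (BanachGL 𝕜 X) E) ∧
        (∃ A, IsHomogeneousStructure
          (MulAction.stabilizer (BanachGL 𝕜 X) E) A) ∧
        ∀ A, IsHomogeneousStructure
            (MulAction.stabilizer (BanachGL 𝕜 X) E) A →
          A.IsBianalyticOnto (grassmannStructure 𝕜 X)
            (MulAction.ofQuotientStabilizer (BanachGL 𝕜 X) E)
            (MulAction.orbit (BanachGL 𝕜 X) E)) ∧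
      -- the space of idempotents is a disjoint union of homogeneous spaces
      ((∃ R : Set (Idem 𝕜 X),
          IsOrbitTransversal (BanachGL 𝕜 X) R) ∧
        ∀ R : Set (Idem 𝕜 X),
          IsOrbitTransversal (BanachGL 𝕜 X) R →
          ∀ A : ∀ Q : R, BanachStructure 𝕜
              (BanachGL 𝕜 X ⧸ MulAction.stabilizer (BanachGL 𝕜 X) Q.1),
            (∀ Q, IsHomogeneousStructure _ (A Q)) →
            (BanachStructure.sigma A).IsBianalyticOnto I
              (fun p => MulAction.ofQuotientStabilizer (BanachGL 𝕜 X) p.1.1 p.2)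
              Set.univ) ∧
      -- the Grassmann manifold is a disjoint union of homogeneous spaces
      ((∃ R : Set (Grassmannian 𝕜 X),
          IsOrbitTransversal (BanachGL 𝕜 X) R) ∧
        ∀ R : Set (Grassmannian 𝕜 X),
          IsOrbitTransversal (BanachGL 𝕜 X) R →
          ∀ A : ∀ E : R, BanachStructure 𝕜
              (BanachGL 𝕜 X ⧸ MulAction.stabilizer (BanachGL 𝕜 X) E.1),
            (∀ E, IsHomogeneousStructure _ (A E)) →
            (BanachStructure.sigma A).IsBianalyticOnto
              (grassmannStructure 𝕜 X)
              (fun p => MulAction.ofQuotientStabilizer (BanachGL 𝕜 X) p.1.1 p.2)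
              Set.univ) ∧
      -- `kappa` corresponds to the natural analytic map between the quotients
      (∀ Q : Idem 𝕜 X,
        ∃ υ : BanachGL 𝕜 X ⧸ MulAction.stabilizer (BanachGL 𝕜 X) Q →
            BanachGL 𝕜 X ⧸
              MulAction.stabilizer (BanachGL 𝕜 X) (kappa Q),
          (∀ W : BanachGL 𝕜 X, υ (QuotientGroup.mk W) = QuotientGroup.mk W) ∧
          kappa ∘ MulAction.ofQuotientStabilizer (BanachGL 𝕜 X) Q =
            MulAction.ofQuotientStabilizer (BanachGL 𝕜 X) (kappa Q) ∘ υ ∧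
          ∀ A B, IsHomogeneousStructure _ A →
            IsHomogeneousStructure _ B → A.IsAnalytic B υ) := by
  refine ⟨exists_isSubmanifoldStructure, fun I hI => ⟨fun Q => ?_, fun E => ?_,
    ⟨exists_isOrbitTransversal _ _, fun R hR A hA => ?_⟩,
    ⟨exists_isOrbitTransversal _ _, fun R hR A hA => ?_⟩, fun Q => ?_⟩⟩
  · have h := hasAnalyticOrbits_idem hI
    exact ⟨isBanachLieSubgroup_stabilizer_idem Q, h.isClopen_orbit Q,
      h.exists_isHomogeneousStructure Q, fun A hA => h.isBianalyticOnto_orbit Q hA⟩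
  · have h := hasAnalyticOrbits_grassmannian (𝕜 := 𝕜) (X := X)
    exact ⟨isBanachLieSubgroup_stabilizer_grassmannian E, h.isClopen_orbit E,
      h.exists_isHomogeneousStructure E, fun A hA => h.isBianalyticOnto_orbit E hA⟩
  · exact (hasAnalyticOrbits_idem hI).isBianalyticOnto_sigma hR A hA
  · exact hasAnalyticOrbits_grassmannian.isBianalyticOnto_sigma hR A hA
  -- Equivariance of `kappa` gives both this inclusion, which makes `υ` well defined, and the
  -- commuting square.
  · have hle : MulAction.stabilizer (BanachGL 𝕜 X) Q ≤
        MulAction.stabilizer (BanachGL 𝕜 X) (kappa Q) := fun W hW => by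
      rw [MulAction.mem_stabilizer_iff] at hW ⊢
      rw [← kappa_smul, hW]
    refine ⟨Quotient.map' id fun V W h => ?_, fun W => rfl, ?_, fun A B hA hB => ?_⟩
    · rw [QuotientGroup.leftRel_apply] at h ⊢
      exact hle h
    · funext x
      obtain ⟨W, rfl⟩ := QuotientGroup.mk_surjective x
      exact kappa_smul W Q
    -- `υ` composed with the first quotient map is the second quotient map, which is analytic.
    · exact BanachStructure.IsSubmersion.isAnalytic_of_comp hA QuotientGroup.mk_surjective hB.1
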